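/- Let $n\ge 1$ and let $\mathcal X$ be either $\mathbb R^n$ or a cube of $\mathbb R^n$. Here a cube has finite positive edge length and edges parallel to the axes, and need be neither open nor closed; a cube of $\mathcal X$ is a cube contained in $\mathcal X$. For a cube $Q$ and a function $g$ let $g_Q:=\frac1{|Q|}\int_Q g$ and, for $q\in[1,\infty]$, let $\|g\|_{L^q(Q,|Q|^{-1}dx)}:=\big[\frac1{|Q|}\int_Q|g|^q\big]^{1/q}$ (the essential supremum of $|g|$ over $Q$ if $q=\infty$). All functions are real-valued; $f^-:=-\min\{f,0\}$, and $L^q_{\rm loc}(\mathcal X)$ is the set of functions on $\mathcal X$ that belong to $L^q(E)$ for every bounded measurable $E\subset\mathcal X$. Let $$\mathcal M_Q(f)(x):=\sup_{\text{cubes }R:\ x\in R\subset Q}\frac1{|R|}\int_R|f|,\qquad \mathcal M(f)(x):=\sup_{\text{cubes }R:\ x\in R\subset\mathcal X}\frac1{|R|}\int_R|f|,$$ and $[f,\mathcal M](g):=f\,\mathcal M(g)-\mathcal M(fg)$. For $p\in[1,\infty]$, $\alpha\in\mathbb R$ and a map $\varphi$ from cubes of $\mathcal X$ to $[0,\infty]$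 put $$N_{p,\alpha}(\varphi):=\sup\Big\{\sum_i|Q_i|\big[|Q_i|^{-\alpha}\varphi(Q_i)\big]^p\Big\}^{1/p}\ \ (p<\infty),\qquad N_{\infty,\alpha}(\varphi):=\sup_{Q}|Q|^{-\alpha}\varphi(Q),$$ where the first supremum is over all collections $\{Q_i\}_i$ of cubes of $\mathcal X$ with pairwise disjoint interiors and the second over all cubes $Q$ of $\mathcal X$. Let $\|f\|_{JN_{(p,q,0)_\alpha}}$, $\|f\|_{\widetilde{JN}_{(p,q,0)_\alpha}}$ and $\|f\|_{RM_{p,q,\alpha}}$ be $N_{p,\alpha}(\varphi)$ with $\varphi(Q)$ equal, respectively, to $\|f-f_Q\|_{L^q(Q,|Q|^{-1}dx)}$, $\|f-|f|_Q\|_{L^q(Q,|Q|^{-1}dx)}$ and $\|f\|_{L^q(Q,|Q|^{-1}dx)}$; each of the corresponding spaces consists of the $f\in L^q_{\rm loc}(\mathcal X)$ for which the quantity is finite. Let $A(f)$, $B(f)$ and $D(f)$ be $N_{p,\alpha}(\varphi)$ with $\varphi(Q)$ equal, respectively, to $\inf_{c\in[0,\infty)}\|f-c\|_{L^q(Q,|Q|^{-1}dx)}$,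 $\|f-\mathcal M_Q(f)\|_{L^q(Q,|Q|^{-1}dx)}$ and $\|[f,\mathcal M](\mathbf 1_Q)\|_{L^q(Q,|Q|^{-1}dx)}$. Let $p,q\in[1,\infty]$ and $\alpha\in\mathbb R$. Two $[0,\infty]$-valued quantities are called equivalent if each is at most a positive finite constant, independent of $f$, times the other. (I) The following are mutually equivalent: (i) $f\in\widetilde{JN}_{(p,q,0)_\alpha}(\mathcal X)$; (ii) $f\in JN_{(p,q,0)_\alpha}(\mathcal X)$ and $f^-\in RM_{p,1,\alpha}(\mathcal X)$; (iii) $f\in L^q_{\rm loc}(\mathcal X)$ and $A(f)<\infty$. Moreover, for $f\in L^q_{\rm loc}(\mathcal X)$, the quantities $\|f\|_{\widetilde{JN}_{(p,q,0)_\alpha}}$, $\|f\|_{JN_{(p,q,0)_\alpha}}+\|f^-\|_{RM_{p,1,\alpha}}$ and $A(f)$ are mutually equivalent. (II) The following are equivalent: (iv) $f\in L^q_{\rm loc}(\mathcal X)$ and $B(f)<\infty$; (v) $f\in L^q_{\rm loc}(\mathcal X)$ and $D(f)<\infty$. Moreover, for $f\in L^q_{\rm loc}(\mathcal X)$, the quantities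 $B(f)$ and $D(f)$ are equivalent. (III) If $q<p$ and $\alpha\ge0$, then (i)--(v) are mutually equivalent and, for $f\in L^q_{\rm loc}(\mathcal X)$, the corresponding five quantities are mutually equivalent. -/

import Mathlib

open MeasureTheory Set
open scoped ENNReal NNReal

noncomputable section

namespace JNC

variable {n : ℕ}

/-- A cube of `ℝⁿ`: a product of `n` bounded intervals with one common edge length `l > 0`; each
interval may or may not contain each of its two endpoints. -/
def IsCube (Q : Set (Fin n → ℝ)) : Prop :=
  ∃ (a : Fin n → ℝ) (l : ℝ) (I : Fin n → Set ℝ), 0 < l ∧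
    (∀ i, Ioo (a i) (a i + l) ⊆ I i ∧ I i ⊆ Icc (a i) (a i + l)) ∧ Q = univ.pi I

/-- A collection of cubes contained in `X` whose interiors are pairwise disjoint. (Such a
collection is automatically countable.) -/
def IsPacking (X : Set (Fin n → ℝ)) (S : Set (Set (Fin n → ℝ))) : Prop :=
  (∀ Q ∈ S, IsCube Q ∧ Q ⊆ X) ∧ S.PairwiseDisjoint interior

/-- The local Lebesgue space `L^q_loc(X)`: `q`-integrability (essential boundedness if `q = ∞`)
on every bounded measurable subset of `X`. -/
def LocLp (q : ℝ≥0∞) (X : Set (Fin n → ℝ)) : Set ((Fin n → ℝ) → ℝ) :=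
  {f | ∀ E ⊆ X, MeasurableSet E → Bornology.IsBounded E → MemLp f q (volume.restrict E)}

/-- The norm of `L^q(Q, |Q|⁻¹ dx)` of a `[0, ∞]`-valued function, i.e. `(⨍_Q g^q)^(1/q)`,
and the essential supremum over `Q` if `q = ∞`. -/
def avgNorm (q : ℝ≥0∞) (Q : Set (Fin n → ℝ)) (g : (Fin n → ℝ) → ℝ≥0∞) : ℝ≥0∞ :=
  eLpNorm g q ((volume Q)⁻¹ • volume.restrict Q)

/-- `m` is a polynomial of degree at most `s` and `f - m` has vanishing moments over `Q` up to
order `s`. -/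
def IsMomentProj (s : ℕ) (Q : Set (Fin n → ℝ)) (f : (Fin n → ℝ) → ℝ)
    (m : MvPolynomial (Fin n) ℝ) : Prop :=
  m.totalDegree ≤ s ∧ ∀ γ : Fin n → ℕ, ∑ i, γ i ≤ s →
    ∫ x in Q, (f x - MvPolynomial.eval x m) * ∏ i, x i ^ γ i = 0

open Classical in
/-- The polynomial function `P_Q^{(s)}(f)`: the unique polynomial of degree at most `s` with
the same moments up to order `s` over `Q` as the integrable function `f`. -/
def polyProj (s : ℕ) (Q : Set (Fin n → ℝ)) (f : (Fin n → ℝ) → ℝ) (x : Fin n → ℝ) : ℝ :=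
  if h : ∃ m, IsMomentProj s Q f m then MvPolynomial.eval x h.choose else 0

/-- For a functional `φ` of cubes: the supremum, over all collections `{Q_i}` of cubes of `X` with
pairwise disjoint interiors, of `{∑_i |Q_i| [|Q_i|^{-α} φ(Q_i)]^p}^{1/p}` if `p < ∞`; and the
supremum of `|Q|^{-α} φ(Q)` over all cubes `Q` of `X` if `p = ∞`. -/
def packingSup (p : ℝ≥0∞) (α : ℝ) (X : Set (Fin n → ℝ)) (φ : Set (Fin n → ℝ) → ℝ≥0∞) : ℝ≥0∞ :=
  if p = ∞ then
    ⨆ (Q : Set (Fin n → ℝ)) (_ : IsCube Q) (_ : Q ⊆ X), volume Q ^ (-α) * φ Q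
  else
    ⨆ (S : Set (Set (Fin n → ℝ))) (_ : IsPacking X S),
      (∑' Q : S, volume (Q : Set (Fin n → ℝ)) *
        (volume (Q : Set (Fin n → ℝ)) ^ (-α) * φ Q) ^ p.toReal) ^ (1 / p.toReal)

/-- The John–Nirenberg–Campanato norm `‖f‖_{JN_{(p,q,s)_α}(X)}` (for `p = ∞`, the Campanato
norm). -/
def normJN (p q : ℝ≥0∞) (s : ℕ) (α : ℝ) (X : Set (Fin n → ℝ)) (f : (Fin n → ℝ) → ℝ) : ℝ≥0∞ :=
  packingSup p α X fun Q => avgNorm q Q fun x => ‖f x - polyProj s Q f x‖ₑ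

/-- The space `JN_{(p,q,s)_α}(X)`. -/
def JN (p q : ℝ≥0∞) (s : ℕ) (α : ℝ) (X : Set (Fin n → ℝ)) : Set ((Fin n → ℝ) → ℝ) :=
  {f | f ∈ LocLp q X ∧ normJN p q s α X f < ∞}

/-- The quantity `‖f‖_{JÑ_{(p,q,s)_α}(X)}`, in which `P_Q^{(s)}(|f|)` replaces `P_Q^{(s)}(f)`. -/
def normJNt (p q : ℝ≥0∞) (s : ℕ) (α : ℝ) (X : Set (Fin n → ℝ)) (f : (Fin n → ℝ) → ℝ) : ℝ≥0∞ :=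
  packingSup p α X fun Q => avgNorm q Q fun x => ‖f x - polyProj s Q (fun y => |f y|) x‖ₑ

/-- The space `JÑ_{(p,q,s)_α}(X)`. -/
def JNt (p q : ℝ≥0∞) (s : ℕ) (α : ℝ) (X : Set (Fin n → ℝ)) : Set ((Fin n → ℝ) → ℝ) :=
  {f | f ∈ LocLp q X ∧ normJNt p q s α X f < ∞}

/-- The Riesz–Morrey norm `‖f‖_{RM_{p,q,α}(X)}`. -/
def normRM (p q : ℝ≥0∞) (α : ℝ) (X : Set (Fin n → ℝ)) (f : (Fin n → ℝ) → ℝ) : ℝ≥0∞ :=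
  packingSup p α X fun Q => avgNorm q Q fun x => ‖f x‖ₑ

/-- The Riesz–Morrey space `RM_{p,q,α}(X)`. -/
def RM (p q : ℝ≥0∞) (α : ℝ) (X : Set (Fin n → ℝ)) : Set ((Fin n → ℝ) → ℝ) :=
  {f | f ∈ LocLp q X ∧ normRM p q α X f < ∞}

/-- The negative part `f⁻ = -min {f, 0}`. -/
def negPt (f : (Fin n → ℝ) → ℝ) (x : Fin n → ℝ) : ℝ := -min (f x) 0

/-- The `[0, ∞]`-valued maximal function of `f` over the cubes contained in `X`. It is `𝓜_Q(f)` if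
`X` is the cube `Q`, and the Hardy–Littlewood maximal function on `X` if `X` is the whole
domain. -/
def maxFn (X : Set (Fin n → ℝ)) (f : (Fin n → ℝ) → ℝ) (x : Fin n → ℝ) : ℝ≥0∞ :=
  ⨆ (R : Set (Fin n → ℝ)) (_ : IsCube R) (_ : x ∈ R) (_ : R ⊆ X),
    (volume R)⁻¹ * ∫⁻ y in R, ‖f y‖ₑ

/-- The commutator `[b, 𝓜](f) = b 𝓜(f) - 𝓜(b f)`, where `𝓜` is the maximal operator on `X`. -/
def commMax (X : Set (Fin n → ℝ)) (b f : (Fin n → ℝ) → ℝ) (x : Fin n → ℝ) : EReal :=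
  (b x : EReal) * (maxFn X f x : EReal) - (maxFn X (fun y => b y * f y) x : EReal)

/-- The quantity built from `inf_{c ≥ 0} ‖f - c‖_{L^q(Q, |Q|⁻¹ dx)}`. -/
def infQuantity (p q : ℝ≥0∞) (α : ℝ) (X : Set (Fin n → ℝ)) (f : (Fin n → ℝ) → ℝ) : ℝ≥0∞ :=
  packingSup p α X fun Q => ⨅ c : ℝ≥0, avgNorm q Q fun x => ‖f x - (c : ℝ)‖ₑ

/-- The quantity built from `(⨍_Q |f - 𝓜_Q(f)|^q)^(1/q)`. -/
def maxQuantity (p q : ℝ≥0∞) (α : ℝ) (X : Set (Fin n → ℝ)) (f : (Fin n → ℝ) → ℝ) : ℝ≥0∞ :=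
  packingSup p α X fun Q => avgNorm q Q fun x => ((f x : EReal) - (maxFn Q f x : EReal)).abs

/-- The quantity built from `(⨍_Q |[f, 𝓜](1_Q)|^q)^(1/q)`, with `𝓜` the maximal operator on `X`. -/
def commQuantity (p q : ℝ≥0∞) (α : ℝ) (X : Set (Fin n → ℝ)) (f : (Fin n → ℝ) → ℝ) : ℝ≥0∞ :=
  packingSup p α X fun Q => avgNorm q Q fun x => (commMax X f (Q.indicator fun _ => 1) x).abs

/-- Any two of the listed elements of `[0, ∞]` are comparable with constant `C`. -/
def Comparable (C : ℝ≥0) (l : List ℝ≥0∞) : Prop :=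
  ∀ A ∈ l, ∀ B ∈ l, A ≤ C * B

end JNC

end

open MeasureTheory Set
open scoped ENNReal NNReal

noncomputable section

namespace JNC

variable {n : ℕ}

/-! ### Cubes -/

/-! Everything reduces to comparisons on single cubes, except one self-improvement step that sums
over packings.

(I) On a cube `Q`, `|f| - f = 2f⁻` gives `‖f - |f|_Q‖ ≤ ‖f - f_Q‖ + 2 (f⁻)_Q`. For `c ≥ 0` one has
`f⁻ ≤ |f - c|` pointwise and `‖f - f_Q‖ ≤ 2‖f - c‖`, and `c = |f|_Q` is an admissible constant. This
closes the circle.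

(II) The two quantities are equal. On `Q` one has `𝓜(1_Q) = 1` and `𝓜(f 1_Q) = 𝓜_Q(f)`, because a
cube `R` meeting `Q` at `x` can be replaced by a cube inside `Q` which contains `R ∩ Q` and is no
larger than `R` (`exists_cube_inter_subset`).

(III) From below: `𝓜_Q(f)` dominates both `0` and `f_Q`, so `|f - 𝓜_Q(f)|` dominates `f⁻` and `(f_Q
- f)⁺`; the mean of the latter is half the `L¹` oscillation (`meanOsc_eq`). From above: with `c =
f_Q`, `|c| ≤ 𝓜_Q(f) ≤ 𝓜_Q(f - c) + |c|`, and `𝓜_Q` maps `L^r` to `L^q` for `q < r`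
(`exists_maxFn_majorant`). With `q < r < p`, both directions need oscillations in `L^q` or `L^r` to
be controlled by those in `L¹`, which is `packingSup_avgNorm_le`.

That self-improvement iterates a Calderón–Zygmund stopping argument. Let `W(Q)` be the supremum of
`∑ |R| osc(R)^p` over packings of `Q`. It is superadditive over packings
(`IsPacking.tsum_packSum_le`), each generation of stopping cubes has at most half the previous
volume, and Hölder turns this into a factor `2^{-(1/r - 1/p)} < 1` per generation. The geometric
series bounds the `L^r` norm of `f - f_Q` on `Q` by a multiple of `W(Q)^{1/p} |Q|^{1/r - 1/p}`. When
`α ≥ 0`, the weight `|Q|^{-α}` is at most that of any subcube, so it can be moved inside `W`. -/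

theorem measurableSet_of_Ioo_subset {I : Set ℝ} {a b : ℝ} (h₁ : Ioo a b ⊆ I) (h₂ : I ⊆ Icc a b) :
    MeasurableSet I := by
  have : I = Ioo a b ∪ (I ∩ {a, b}) := by
    ext x
    constructor
    · intro hx
      rcases (h₂ hx).1.eq_or_lt with h | h
      · exact Or.inr ⟨hx, by simp [h]⟩
      rcases (h₂ hx).2.eq_or_lt with h' | h'
      · exact Or.inr ⟨hx, by simp [h']⟩
      · exact Or.inl ⟨h, h'⟩
    · rintro (hx | hx)
      exacts [h₁ hx, hx.1]
  rw [this]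
  exact measurableSet_Ioo.union ((toFinite {a, b}).subset inter_subset_right).measurableSet

/-- A set squeezed between the open and the closed cube with corner `a` and edge length `l`. -/
structure IsCubeWith (a : Fin n → ℝ) (l : ℝ) (Q : Set (Fin n → ℝ)) : Prop where
  pos : 0 < l
  measurableSet : MeasurableSet Q
  Ioo_subset : univ.pi (fun i => Ioo (a i) (a i + l)) ⊆ Q
  subset_Icc : Q ⊆ univ.pi (fun i => Icc (a i) (a i + l))

theorem isCubeWith_pi {a : Fin n → ℝ} {l : ℝ} {I : Fin n → Set ℝ} (hl : 0 < l)
    (h : ∀ i, Ioo (a i) (a i + l) ⊆ I i ∧ I i ⊆ Icc (a i) (a i + l)) :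
    IsCubeWith a l (univ.pi I) where
  pos := hl
  measurableSet := MeasurableSet.univ_pi fun i => measurableSet_of_Ioo_subset (h i).1 (h i).2
  Ioo_subset := pi_mono fun i _ => (h i).1
  subset_Icc := pi_mono fun i _ => (h i).2

theorem IsCube.exists_isCubeWith {Q : Set (Fin n → ℝ)} (hQ : IsCube Q) :
    ∃ a l, IsCubeWith a l Q := by
  obtain ⟨a, l, I, hl, h, rfl⟩ := hQ
  exact ⟨a, l, isCubeWith_pi hl h⟩

namespace IsCubeWith

variable {a : Fin n → ℝ} {l : ℝ} {Q : Set (Fin n → ℝ)}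

/-- The metric on `Fin n → ℝ` is the sup metric, whose balls are cubes. Sandwiching a cube between
an open and a closed ball of equal volume makes its boundary negligible and gives access to covering
and differentiation theorems for balls. -/
theorem subset_closedBall (h : IsCubeWith a l Q) :
    Q ⊆ Metric.closedBall (fun i => a i + l / 2) (l / 2) := by
  intro x hx
  rw [Metric.mem_closedBall, dist_pi_le_iff (by linarith [h.pos])]
  intro i
  have := h.subset_Icc hx i (mem_univ i)
  rw [Real.dist_eq, abs_le]
  constructor <;> linarith [this.1, this.2]

theorem ball_subset (h : IsCubeWith a l Q) :
    Metric.ball (fun i => a i + l / 2) (l / 2) ⊆ Q := by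
  intro x hx
  rw [Metric.mem_ball, dist_pi_lt_iff (by linarith [h.pos])] at hx
  refine h.Ioo_subset fun i _ => ?_
  have := hx i
  rw [Real.dist_eq, abs_lt] at this
  constructor <;> linarith [this.1, this.2]

theorem volume_ball (h : IsCubeWith a l Q) :
    volume (Metric.ball (fun i => a i + l / 2) (l / 2)) = ENNReal.ofReal l ^ n := by
  rw [Real.volume_pi_ball _ (by linarith [h.pos]), mul_div_cancel₀ _ (by norm_num),
    ENNReal.ofReal_pow h.pos.le, Fintype.card_fin]

theorem volume_closedBall (h : IsCubeWith a l Q) :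
    volume (Metric.closedBall (fun i => a i + l / 2) (l / 2)) = ENNReal.ofReal l ^ n := by
  rw [Real.volume_pi_closedBall _ (by linarith [h.pos]), mul_div_cancel₀ _ (by norm_num),
    ENNReal.ofReal_pow h.pos.le, Fintype.card_fin]

theorem volume_eq (h : IsCubeWith a l Q) : volume Q = ENNReal.ofReal l ^ n :=
  le_antisymm ((measure_mono h.subset_closedBall).trans h.volume_closedBall.le)
    (h.volume_ball.ge.trans (measure_mono h.ball_subset))

theorem ae_eq_ball (h : IsCubeWith a l Q) :
    Metric.ball (fun i => a i + l / 2) (l / 2) =ᵐ[volume] Q :=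
  ae_eq_of_subset_of_measure_ge h.ball_subset (by rw [h.volume_ball, h.volume_eq])
    measurableSet_ball.nullMeasurableSet (by rw [h.volume_eq]; finiteness)

theorem ae_eq_closedBall (h : IsCubeWith a l Q) :
    Q =ᵐ[volume] Metric.closedBall (fun i => a i + l / 2) (l / 2) :=
  ae_eq_of_subset_of_measure_ge h.subset_closedBall (by rw [h.volume_closedBall, h.volume_eq])
    h.measurableSet.nullMeasurableSet (by rw [h.volume_closedBall]; finiteness)

end IsCubeWith

namespace IsCube

variable {Q R : Set (Fin n → ℝ)}

theorem measurableSet (hQ : IsCube Q) : MeasurableSet Q := by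
  obtain ⟨a, l, h⟩ := hQ.exists_isCubeWith
  exact h.measurableSet

theorem isBounded (hQ : IsCube Q) : Bornology.IsBounded Q := by
  obtain ⟨a, l, h⟩ := hQ.exists_isCubeWith
  exact Metric.isBounded_closedBall.subset h.subset_closedBall

theorem volume_ne_top (hQ : IsCube Q) : volume Q ≠ ∞ := hQ.isBounded.measure_lt_top.ne

theorem volume_ne_zero (hQ : IsCube Q) : volume Q ≠ 0 := by
  obtain ⟨a, l, h⟩ := hQ.exists_isCubeWith
  rw [h.volume_eq]
  exact pow_ne_zero _ (by simpa using h.pos)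

theorem interior_nonempty (hQ : IsCube Q) : (interior Q).Nonempty := by
  obtain ⟨a, l, h⟩ := hQ.exists_isCubeWith
  exact ⟨_, interior_maximal h.ball_subset Metric.isOpen_ball
    (Metric.mem_ball_self (by linarith [h.pos]))⟩

theorem interior_ae_eq (hQ : IsCube Q) : interior Q =ᵐ[volume] Q := by
  obtain ⟨a, l, h⟩ := hQ.exists_isCubeWith
  have := interior_maximal h.ball_subset Metric.isOpen_ball
  refine Filter.EventuallyLE.antisymm interior_subset.eventuallyLE ?_
  exact h.ae_eq_ball.symm.le.trans this.eventuallyLE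

theorem isProbabilityMeasure (hQ : IsCube Q) :
    IsProbabilityMeasure ((volume Q)⁻¹ • (volume : Measure (Fin n → ℝ)).restrict Q) :=
  ⟨by simp [ENNReal.inv_mul_cancel hQ.volume_ne_zero hQ.volume_ne_top]⟩

end IsCube

/-! ### Averages -/

/-- The mean oscillation `⨍_Q |f - f_Q|`. -/
def meanOsc (f : (Fin n → ℝ) → ℝ) (Q : Set (Fin n → ℝ)) : ℝ≥0∞ :=
  (volume Q)⁻¹ * ∫⁻ x in Q, ‖f x - ⨍ y in Q, f y‖ₑ

theorem avgNorm_one (Q : Set (Fin n → ℝ)) (g : (Fin n → ℝ) → ℝ≥0∞) :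
    avgNorm 1 Q g = (volume Q)⁻¹ * ∫⁻ x in Q, g x := by
  rw [avgNorm, eLpNorm_one_eq_lintegral_enorm, lintegral_smul_measure]
  simp

theorem avgNorm_one_sub_average (Q : Set (Fin n → ℝ)) (f : (Fin n → ℝ) → ℝ) :
    avgNorm 1 Q (fun x => ‖f x - ⨍ y in Q, f y‖ₑ) = meanOsc f Q :=
  avgNorm_one ..

theorem avgNorm_ofReal {r : ℝ} (hr : 0 < r) (Q : Set (Fin n → ℝ)) (g : (Fin n → ℝ) → ℝ≥0∞) :
    avgNorm (ENNReal.ofReal r) Q g = ((volume Q)⁻¹ * ∫⁻ x in Q, g x ^ r) ^ (1 / r) := by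
  rw [avgNorm, eLpNorm_eq_lintegral_rpow_enorm_toReal (by simpa using hr) (by simp),
    lintegral_smul_measure, ENNReal.toReal_ofReal hr.le]
  simp

theorem average_eq_integral {Q : Set (Fin n → ℝ)} (f : (Fin n → ℝ) → ℝ) :
    ⨍ x in Q, f x = ∫ x, f x ∂((volume Q)⁻¹ • volume.restrict Q) := by
  rw [average]
  simp

theorem ae_smul_iff {Q : Set (Fin n → ℝ)} (hQ : IsCube Q) {P : (Fin n → ℝ) → Prop} :
    (∀ᵐ x ∂((volume Q)⁻¹ • volume.restrict Q), P x) ↔ ∀ᵐ x ∂volume.restrict Q, P x :=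
  Measure.ae_ennreal_smul_measure_iff (by simpa using hQ.volume_ne_top)

theorem avgNorm_mono_ae {q : ℝ≥0∞} {Q : Set (Fin n → ℝ)} {g h : (Fin n → ℝ) → ℝ≥0∞}
    (hQ : IsCube Q) (H : ∀ᵐ x ∂volume.restrict Q, g x ≤ h x) : avgNorm q Q g ≤ avgNorm q Q h :=
  eLpNorm_mono_enorm_ae (by simpa [ae_smul_iff hQ] using H)

theorem avgNorm_mono {q : ℝ≥0∞} {Q : Set (Fin n → ℝ)} {g h : (Fin n → ℝ) → ℝ≥0∞}
    (hQ : IsCube Q) (H : ∀ x ∈ Q, g x ≤ h x) : avgNorm q Q g ≤ avgNorm q Q h :=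
  avgNorm_mono_ae hQ ((ae_restrict_iff' hQ.measurableSet).2 (.of_forall H))

theorem avgNorm_congr {q : ℝ≥0∞} {Q : Set (Fin n → ℝ)} {g h : (Fin n → ℝ) → ℝ≥0∞}
    (hQ : IsCube Q) (H : ∀ x ∈ Q, g x = h x) : avgNorm q Q g = avgNorm q Q h :=
  le_antisymm (avgNorm_mono hQ fun x hx => (H x hx).le) (avgNorm_mono hQ fun x hx => (H x hx).ge)

theorem avgNorm_mono_exponent {q r : ℝ≥0∞} {Q : Set (Fin n → ℝ)} {g : (Fin n → ℝ) → ℝ≥0∞}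
    (hQ : IsCube Q) (hqr : q ≤ r) (hg : AEMeasurable g (volume.restrict Q)) :
    avgNorm q Q g ≤ avgNorm r Q g := by
  have := hQ.isProbabilityMeasure
  exact eLpNorm_le_eLpNorm_of_exponent_le hqr (hg.smul_measure _).aestronglyMeasurable

theorem avgNorm_add_le {q : ℝ≥0∞} {Q : Set (Fin n → ℝ)} {g h : (Fin n → ℝ) → ℝ≥0∞}
    (hq : 1 ≤ q) (hg : AEMeasurable g (volume.restrict Q))
    (hh : AEMeasurable h (volume.restrict Q)) :
    avgNorm q Q (fun x => g x + h x) ≤ avgNorm q Q g + avgNorm q Q h :=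
  eLpNorm_add_le (hg.smul_measure _).aestronglyMeasurable (hh.smul_measure _).aestronglyMeasurable
    hq

theorem avgNorm_const {q : ℝ≥0∞} {Q : Set (Fin n → ℝ)} (hQ : IsCube Q) (hq : q ≠ 0) (c : ℝ≥0∞) :
    avgNorm q Q (fun _ => c) = c := by
  have := hQ.isProbabilityMeasure
  rw [avgNorm, eLpNorm_const c hq (IsProbabilityMeasure.ne_zero _)]
  simp

theorem enorm_average_le (Q : Set (Fin n → ℝ)) (f : (Fin n → ℝ) → ℝ) :
    ‖⨍ x in Q, f x‖ₑ ≤ (volume Q)⁻¹ * ∫⁻ x in Q, ‖f x‖ₑ := by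
  rw [average_eq_integral]
  refine (enorm_integral_le_lintegral_enorm _).trans ?_
  rw [lintegral_smul_measure, smul_eq_mul]

theorem average_sub_const {Q : Set (Fin n → ℝ)} (hQ : IsCube Q) {f : (Fin n → ℝ) → ℝ}
    (hf : IntegrableOn f Q) (c : ℝ) : ⨍ x in Q, (f x - c) = (⨍ x in Q, f x) - c := by
  have := hQ.isProbabilityMeasure
  rw [average_eq_integral, average_eq_integral, integral_sub _ (integrable_const _)]
  · simp
  · exact hf.smul_measure (by simpa using hQ.volume_ne_zero)

/-- For `s = 0` the polynomial is a constant, and the only moment condition is that `f` minus this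
constant has integral zero. -/
theorem polyProj_zero {Q : Set (Fin n → ℝ)} (hQ : IsCube Q) {f : (Fin n → ℝ) → ℝ}
    (hf : IntegrableOn f Q) (x : Fin n → ℝ) : polyProj 0 Q f x = ⨍ y in Q, f y := by
  have key : ∀ c : ℝ, ∫ y in Q, (f y - c) = 0 ↔ c = ⨍ y in Q, f y := by
    intro c
    have h := average_sub_const hQ hf c
    rw [setAverage_eq] at h
    have hv : (volume.real Q)⁻¹ ≠ 0 := by
      rw [ne_eq, inv_eq_zero, measureReal_def, ENNReal.toReal_eq_zero_iff]
      simp [hQ.volume_ne_zero, hQ.volume_ne_top]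
    constructor
    · intro h0
      rw [h0, smul_zero] at h
      linarith
    · intro h0
      rw [h0, sub_self] at h
      rw [h0]
      exact (smul_eq_zero.1 h).resolve_left hv
  have hex : ∃ m, IsMomentProj 0 Q f m := by
    refine ⟨MvPolynomial.C (⨍ y in Q, f y), by simp, fun γ hγ => ?_⟩
    have hγ' : ∀ i, γ i = 0 := by simpa using hγ
    simp only [MvPolynomial.eval_C, hγ', pow_zero, Finset.prod_const_one, mul_one]
    exact (key _).2 rfl
  rw [polyProj, dif_pos hex]
  obtain ⟨h1, h2⟩ := hex.choose_spec
  have hC := MvPolynomial.totalDegree_eq_zero_iff_eq_C.1 (Nat.le_zero.1 h1)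
  rw [hC, MvPolynomial.eval_C]
  refine (key _).1 ?_
  have := h2 0 (by simp)
  rw [hC] at this
  simpa using this

/-! ### Packings -/

namespace IsPacking

variable {X Y : Set (Fin n → ℝ)} {S T : Set (Set (Fin n → ℝ))}

theorem mono (h : IsPacking X S) (hXY : X ⊆ Y) : IsPacking Y S :=
  ⟨fun Q hQ => ⟨(h.1 Q hQ).1, (h.1 Q hQ).2.trans hXY⟩, h.2⟩

theorem subset (h : IsPacking X S) (hT : T ⊆ S) : IsPacking X T :=
  ⟨fun Q hQ => h.1 Q (hT hQ), h.2.subset hT⟩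

theorem countable (h : IsPacking X S) : S.Countable :=
  h.2.countable_of_isOpen (fun _ _ => isOpen_interior) fun Q hQ => (h.1 Q hQ).1.interior_nonempty

theorem tsum_volume_le (h : IsPacking X S) :
    ∑' Q : S, volume (Q : Set (Fin n → ℝ)) ≤ volume X := by
  have := h.countable.to_subtype
  calc ∑' Q : S, volume (Q : Set (Fin n → ℝ))
      = ∑' Q : S, volume (interior (Q : Set (Fin n → ℝ))) := by
        congr 1 with Q
        exact (measure_congr (h.1 Q Q.2).1.interior_ae_eq).symm
    _ = volume (⋃ Q : S, interior (Q : Set (Fin n → ℝ))) :=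
        (measure_iUnion (fun (Q R : S) hQR => h.2 Q.2 R.2 (Subtype.coe_injective.ne hQR))
          fun _ => isOpen_interior.measurableSet).symm
    _ ≤ volume X := measure_mono (iUnion_subset fun Q => interior_subset.trans (h.1 Q Q.2).2)

end IsPacking

theorem isPacking_singleton {Q : Set (Fin n → ℝ)} (hQ : IsCube Q) : IsPacking Q {Q} :=
  ⟨by rintro _ rfl; exact ⟨hQ, subset_rfl⟩, pairwiseDisjoint_singleton _ _⟩

/-- The supremum of `∑_i w(Q_i)` over all packings `{Q_i}` of `X`. -/
def packSum (w : Set (Fin n → ℝ) → ℝ≥0∞) (X : Set (Fin n → ℝ)) : ℝ≥0∞ :=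
  ⨆ (S : Set (Set (Fin n → ℝ))) (_ : IsPacking X S), ∑' Q : S, w Q

theorem IsPacking.tsum_le_packSum {X : Set (Fin n → ℝ)} {S : Set (Set (Fin n → ℝ))}
    (h : IsPacking X S) (w : Set (Fin n → ℝ) → ℝ≥0∞) : ∑' Q : S, w Q ≤ packSum w X :=
  le_iSup₂_of_le S h le_rfl

theorem le_packSum {Q : Set (Fin n → ℝ)} (hQ : IsCube Q) (w : Set (Fin n → ℝ) → ℝ≥0∞) :
    w Q ≤ packSum w Q := by
  simpa using (isPacking_singleton hQ).tsum_le_packSum w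

theorem packSum_mono_set {X Y : Set (Fin n → ℝ)} (h : X ⊆ Y) (w : Set (Fin n → ℝ) → ℝ≥0∞) :
    packSum w X ≤ packSum w Y :=
  iSup₂_le fun _ hS => (hS.mono h).tsum_le_packSum w

theorem packSum_mul_le {X : Set (Fin n → ℝ)} {w v : Set (Fin n → ℝ) → ℝ≥0∞} {c : ℝ≥0∞}
    (h : ∀ Q, IsCube Q → Q ⊆ X → c * w Q ≤ v Q) : c * packSum w X ≤ packSum v X := by
  simp only [packSum, ENNReal.mul_iSup, ← ENNReal.tsum_mul_left]
  exact iSup₂_mono fun S hS => ENNReal.tsum_le_tsum fun Q => h Q (hS.1 Q Q.2).1 (hS.1 Q Q.2).2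

/-- Packings of the members of a packing splice together into a packing of `X`. The induction
carries an arbitrary bound `B` for the sums over packings subordinate to `F`, so that the suprema
can be treated one cube at a time without choosing near-optimal packings. -/
theorem finset_sum_packSum_le {X : Set (Fin n → ℝ)} (w : Set (Fin n → ℝ) → ℝ≥0∞)
    (F : Finset (Set (Fin n → ℝ))) (hF : IsPacking X F) :
    ∑ Q ∈ F, packSum w Q ≤ packSum w X := by
  classical
  suffices H : ∀ F : Finset (Set (Fin n → ℝ)), IsPacking X F → ∀ B : ℝ≥0∞,
      (∀ T, IsPacking X T → (∀ R ∈ T, ∃ Q ∈ F, R ⊆ Q) → ∑' R : T, w R ≤ B) →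
      ∑ Q ∈ F, packSum w Q ≤ B from
    H F hF _ fun T hT _ => hT.tsum_le_packSum w
  intro F
  induction F using Finset.induction_on with
  | empty => simp
  | insert Q F hQF ih =>
    intro hF B hB
    rw [Finset.sum_insert hQF]
    have hFX : IsPacking X F := hF.subset (by simp)
    have hQX := hF.1 Q (by simp)
    have hS0 : IsPacking (Q : Set (Fin n → ℝ)) ∅ := ⟨by simp, by simp⟩
    have : Nonempty {S // IsPacking Q S} := ⟨⟨∅, hS0⟩⟩
    rw [packSum, iSup_subtype', ENNReal.iSup_add]
    refine iSup_le fun ⟨S, hS⟩ => ?_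
    by_cases hfin : ∑' R : S, w R = ∞
    · have := hB S (hS.mono hQX.2) fun R hR => ⟨Q, by simp, (hS.1 R hR).2⟩
      rw [hfin, top_le_iff] at this
      simp [this]
    rw [add_comm]
    -- The packing `S` of `Q` is now fixed. A packing `T` subordinate to `F` can be joined to `S`,
    -- so its sum is at most `B` minus the sum over `S`.
    refine (add_le_add_left (ih hFX (B - ∑' R : S, w R) fun T hT hTF => ?_) _).trans ?_
    · refine ENNReal.le_sub_of_add_le_right hfin ?_
      have hcross : ∀ R ∈ T, ∀ R' ∈ S, Disjoint (interior R) (interior R') := by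
        intro R hR R' hR'
        obtain ⟨Q', hQ', hRQ'⟩ := hTF R hR
        have : Q' ≠ Q := by rintro rfl; exact hQF hQ'
        exact (hF.2 (by simp [hQ']) (by simp) this).mono (interior_mono hRQ')
          (interior_mono (hS.1 R' hR').2)
      -- Disjoint interiors, being nonempty, exclude a cube common to `T` and `S`; otherwise the sum
      -- over `T ∪ S` would count it only once.
      have hdisj : Disjoint T S := by
        rw [Set.disjoint_left]
        intro R hR hR'
        have := hcross R hR R hR'
        rw [disjoint_self] at this
        exact (hT.1 R hR).1.interior_nonempty.ne_empty this
      rw [← ENNReal.summable.tsum_union_disjoint hdisj ENNReal.summable]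
      refine hB _ ⟨?_, ?_⟩ ?_
      · rintro R (hR | hR)
        exacts [hT.1 R hR, (hS.mono hQX.2).1 R hR]
      · rw [pairwiseDisjoint_union]
        exact ⟨hT.2, hS.2, fun R hR R' hR' _ => hcross R hR R' hR'⟩
      · rintro R (hR | hR)
        · obtain ⟨Q', hQ', h⟩ := hTF R hR
          exact ⟨Q', by simp [hQ'], h⟩
        · exact ⟨Q, by simp, (hS.1 R hR).2⟩
    · rw [tsub_add_cancel_of_le]
      exact hB S (hS.mono hQX.2) fun R hR => ⟨Q, by simp, (hS.1 R hR).2⟩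

theorem IsPacking.tsum_packSum_le {X : Set (Fin n → ℝ)} {S : Set (Set (Fin n → ℝ))}
    (hS : IsPacking X S) (w : Set (Fin n → ℝ) → ℝ≥0∞) :
    ∑' Q : S, packSum w Q ≤ packSum w X := by
  classical
  refine ENNReal.summable.tsum_le_of_sum_le fun F => ?_
  have : ∑ Q ∈ F, packSum w Q = ∑ Q ∈ F.map (Function.Embedding.subtype _), packSum w Q := by
    simp
  rw [this]
  refine finset_sum_packSum_le w _ (hS.subset ?_)
  intro Q hQ
  simp only [Finset.coe_map, mem_image] at hQ
  obtain ⟨R, _, rfl⟩ := hQ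
  exact R.2

/-! ### The functional `packingSup` -/

section

variable {p : ℝ≥0∞} {α : ℝ} {X : Set (Fin n → ℝ)}

theorem packingSup_top (φ : Set (Fin n → ℝ) → ℝ≥0∞) : packingSup ∞ α X φ =
    ⨆ (Q : Set (Fin n → ℝ)) (_ : IsCube Q) (_ : Q ⊆ X), volume Q ^ (-α) * φ Q :=
  if_pos rfl

theorem packingSup_of_ne_top (hp : 1 ≤ p) (hp' : p ≠ ∞) (φ : Set (Fin n → ℝ) → ℝ≥0∞) :
    packingSup p α X φ =
      packSum (fun Q => volume Q * (volume Q ^ (-α) * φ Q) ^ p.toReal) X ^ (1 / p.toReal) := by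
  have h0 : 0 < 1 / p.toReal :=
    one_div_pos.2 (ENNReal.toReal_pos (zero_lt_one.trans_le hp).ne' hp')
  rw [packingSup, if_neg hp', packSum]
  have := (ENNReal.orderIsoRpow (1 / p.toReal) h0).map_iSup₂
    (fun S (_ : IsPacking X S) => ∑' Q : S, volume (Q : Set (Fin n → ℝ)) *
        (volume (Q : Set (Fin n → ℝ)) ^ (-α) * φ Q) ^ p.toReal)
  exact this.symm

theorem packingSup_le_mul (hp : 1 ≤ p) {φ ψ : Set (Fin n → ℝ) → ℝ≥0∞} (C : ℝ≥0∞)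
    (h : ∀ Q, IsCube Q → Q ⊆ X → φ Q ≤ C * ψ Q) :
    packingSup p α X φ ≤ C * packingSup p α X ψ := by
  rcases eq_or_ne p ∞ with rfl | hp'
  · simp only [packingSup_top, ENNReal.mul_iSup]
    refine iSup₂_mono fun Q hQ => iSup_mono fun hQX => ?_
    rw [mul_left_comm]
    gcongr
    exact h Q hQ hQX
  · have hpos : 0 < p.toReal := ENNReal.toReal_pos (zero_lt_one.trans_le hp).ne' hp'
    rw [packingSup_of_ne_top hp hp', packingSup_of_ne_top hp hp', one_div,
      ENNReal.rpow_inv_le_iff hpos, ENNReal.mul_rpow_of_nonneg _ _ hpos.le,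
      ENNReal.rpow_inv_rpow hpos.ne']
    refine iSup₂_le fun S hS => ?_
    grw [← hS.tsum_le_packSum, ← ENNReal.tsum_mul_left]
    refine ENNReal.tsum_le_tsum fun Q => ?_
    beta_reduce
    rw [mul_left_comm, ← ENNReal.mul_rpow_of_nonneg _ _ hpos.le, mul_left_comm]
    gcongr
    exact h Q (hS.1 Q Q.2).1 (hS.1 Q Q.2).2

theorem packingSup_mono (hp : 1 ≤ p) {φ ψ : Set (Fin n → ℝ) → ℝ≥0∞}
    (h : ∀ Q, IsCube Q → Q ⊆ X → φ Q ≤ ψ Q) : packingSup p α X φ ≤ packingSup p α X ψ := by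
  simpa using packingSup_le_mul (α := α) hp (ψ := ψ) 1 (by simpa using h)

theorem packingSup_congr (hp : 1 ≤ p) {φ ψ : Set (Fin n → ℝ) → ℝ≥0∞}
    (h : ∀ Q, IsCube Q → Q ⊆ X → φ Q = ψ Q) : packingSup p α X φ = packingSup p α X ψ :=
  le_antisymm (packingSup_mono hp fun Q hQ hX => (h Q hQ hX).le)
    (packingSup_mono hp fun Q hQ hX => (h Q hQ hX).ge)

/-- Uses only `max(a, b)^p ≤ a^p + b^p` and the subadditivity of `t ↦ t^{1/p}`. Working with maxima
avoids Minkowski's inequality for packing sums, at the price of a factor 2 in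
`packingSup_le_mul_add`. -/
theorem packingSup_sup_le (hp : 1 ≤ p) (φ ψ : Set (Fin n → ℝ) → ℝ≥0∞) :
    packingSup p α X (fun Q => φ Q ⊔ ψ Q) ≤ packingSup p α X φ + packingSup p α X ψ := by
  rcases eq_or_ne p ∞ with rfl | hp'
  · simp only [packingSup_top]
    refine iSup₂_le fun Q hQ => iSup_le fun hQX => ?_
    rcases le_total (φ Q) (ψ Q) with h | h
    · rw [sup_of_le_right h]
      exact le_add_left (le_iSup₂_of_le Q hQ (le_iSup_of_le hQX le_rfl))
    · rw [sup_of_le_left h]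
      exact le_add_right (le_iSup₂_of_le Q hQ (le_iSup_of_le hQX le_rfl))
  · have hpos : 0 < p.toReal := ENNReal.toReal_pos (zero_lt_one.trans_le hp).ne' hp'
    simp only [packingSup_of_ne_top hp hp']
    have h1 : 1 / p.toReal ≤ 1 := by
      rw [div_le_one hpos]
      simpa using ENNReal.toReal_mono hp' hp
    refine le_trans ?_ (ENNReal.rpow_add_le_add_rpow _ _ (by positivity) h1)
    refine ENNReal.rpow_le_rpow ?_ (by positivity)
    refine iSup₂_le fun S hS => ?_
    grw [← hS.tsum_le_packSum, ← hS.tsum_le_packSum, ← ENNReal.tsum_add]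
    refine ENNReal.tsum_le_tsum fun Q => ?_
    beta_reduce
    rcases le_total (φ Q) (ψ Q) with h | h
    · rw [sup_of_le_right h]
      exact le_add_left le_rfl
    · rw [sup_of_le_left h]
      exact le_add_right le_rfl

theorem packingSup_le_mul_add (hp : 1 ≤ p) {φ ψ₁ ψ₂ : Set (Fin n → ℝ) → ℝ≥0∞} (C : ℝ≥0∞)
    (h : ∀ Q, IsCube Q → Q ⊆ X → φ Q ≤ C * (ψ₁ Q + ψ₂ Q)) :
    packingSup p α X φ ≤ 2 * C * (packingSup p α X ψ₁ + packingSup p α X ψ₂) := by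
  refine (packingSup_le_mul hp (ψ := fun Q => ψ₁ Q ⊔ ψ₂ Q) (2 * C) fun Q hQ hX => ?_).trans
    (mul_le_mul_right (packingSup_sup_le hp _ _) _)
  refine (h Q hQ hX).trans ?_
  rw [mul_comm 2 C, mul_assoc, two_mul]
  gcongr
  exacts [le_sup_left, le_sup_right]

end

/-! ### Comparison of `JN`, its variant with `|f|_Q`, and the infimum over nonnegative constants -/

section

variable {p q : ℝ≥0∞} {α : ℝ} {X Q : Set (Fin n → ℝ)} {f : (Fin n → ℝ) → ℝ}

theorem LocLp.memLp (hf : f ∈ LocLp q X) (hQ : IsCube Q) (hQX : Q ⊆ X) :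
    MemLp f q (volume.restrict Q) :=
  hf Q hQX hQ.measurableSet hQ.isBounded

theorem LocLp.integrableOn (hq : 1 ≤ q) (hf : f ∈ LocLp q X) (hQ : IsCube Q) (hQX : Q ⊆ X) :
    IntegrableOn f Q := by
  have : IsFiniteMeasure ((volume : Measure (Fin n → ℝ)).restrict Q) :=
    ⟨by simpa using hQ.volume_ne_top.lt_top⟩
  exact (LocLp.memLp hf hQ hQX).integrable hq

theorem LocLp.mono_exponent {r : ℝ≥0∞} (hrq : r ≤ q) (hf : f ∈ LocLp q X) : f ∈ LocLp r X := by
  intro E hEX hE hEb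
  have : IsFiniteMeasure ((volume : Measure (Fin n → ℝ)).restrict E) :=
    ⟨by simpa using hEb.measure_lt_top⟩
  exact (hf E hEX hE hEb).mono_exponent hrq

theorem negPt_eq_max (f : (Fin n → ℝ) → ℝ) (x : Fin n → ℝ) : negPt f x = max (-f x) 0 := by
  rw [negPt, ← max_neg_neg, neg_zero]

theorem negPt_eq (f : (Fin n → ℝ) → ℝ) : negPt f = fun x => 2⁻¹ * (|f x| - f x) := by
  ext x
  rw [negPt_eq_max]
  rcases le_total 0 (f x) with h | h
  · rw [abs_of_nonneg h, max_eq_right (by linarith)]; ring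
  · rw [abs_of_nonpos h, max_eq_left (by linarith)]; ring

theorem LocLp.negPt (hf : f ∈ LocLp q X) : JNC.negPt f ∈ LocLp q X := by
  intro E hEX hE hEb
  have := hf E hEX hE hEb
  rw [negPt_eq]
  exact (this.norm.sub this).const_mul 2⁻¹

theorem enorm_negPt_le (f : (Fin n → ℝ) → ℝ) (x : Fin n → ℝ) {c : ℝ} (hc : 0 ≤ c) :
    ‖negPt f x‖ₑ ≤ ‖f x - c‖ₑ := by
  refine enorm_le_iff_norm_le.2 ?_
  rw [negPt_eq_max, Real.norm_eq_abs, Real.norm_eq_abs, abs_of_nonneg (le_max_right _ _)]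
  refine max_le ?_ (abs_nonneg _)
  linarith [neg_abs_le (f x - c)]

theorem aemeasurable_enorm_sub (hf : IntegrableOn f Q) (c : ℝ) :
    AEMeasurable (fun x => ‖f x - c‖ₑ) (volume.restrict Q) :=
  (hf.aemeasurable.sub_const c).enorm

theorem avgNorm_sub_polyProj (hQ : IsCube Q) (hf : IntegrableOn f Q) :
    avgNorm q Q (fun x => ‖f x - polyProj 0 Q f x‖ₑ) =
      avgNorm q Q (fun x => ‖f x - ⨍ y in Q, f y‖ₑ) := by
  simp only [polyProj_zero hQ hf]

theorem avgNorm_sub_polyProj_abs (hQ : IsCube Q) (hf : IntegrableOn f Q) :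
    avgNorm q Q (fun x => ‖f x - polyProj 0 Q (fun y => |f y|) x‖ₑ) =
      avgNorm q Q (fun x => ‖f x - ⨍ y in Q, |f y|‖ₑ) := by
  simp only [polyProj_zero hQ hf.abs]

/-- Average the identity `|f| - f = 2f⁻`. -/
theorem enorm_average_abs_sub_le (hf : IntegrableOn f Q) :
    ‖(⨍ y in Q, |f y|) - ⨍ y in Q, f y‖ₑ ≤ 2 * avgNorm 1 Q (fun x => ‖negPt f x‖ₑ) := by
  have h : (⨍ y in Q, |f y|) - ⨍ y in Q, f y = ⨍ y in Q, 2 * negPt f y := by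
    simp only [setAverage_eq, negPt_eq]
    rw [← smul_sub, ← integral_sub hf.abs hf]
    congr 2
    ext x
    ring
  rw [h, avgNorm_one]
  refine (enorm_average_le _ _).trans ?_
  simp only [enorm_mul]
  rw [lintegral_const_mul' _ _ (by simp), ← mul_assoc, ← mul_assoc, mul_comm (volume Q)⁻¹]
  gcongr
  simp [Real.enorm_eq_ofReal]

theorem avgNorm_sub_average_abs_le (hq : 1 ≤ q) (hQ : IsCube Q) (hf : IntegrableOn f Q) :
    avgNorm q Q (fun x => ‖f x - ⨍ y in Q, |f y|‖ₑ) ≤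
      avgNorm q Q (fun x => ‖f x - ⨍ y in Q, f y‖ₑ) +
        2 * avgNorm 1 Q (fun x => ‖negPt f x‖ₑ) := by
  set c := ⨍ y in Q, f y with hc
  set d := ⨍ y in Q, |f y| with hd
  have h1 : avgNorm q Q (fun x => ‖f x - d‖ₑ) ≤ avgNorm q Q (fun x => ‖f x - c‖ₑ + ‖d - c‖ₑ) := by
    refine avgNorm_mono hQ fun x _ => ?_
    have : f x - d = (f x - c) - (d - c) := by ring
    rw [this]
    exact enorm_sub_le
  refine h1.trans ((avgNorm_add_le hq (aemeasurable_enorm_sub hf c) aemeasurable_const).trans ?_)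
  rw [avgNorm_const hQ (zero_lt_one.trans_le hq).ne']
  gcongr
  exact enorm_average_abs_sub_le hf

theorem enorm_average_sub_le (hq : 1 ≤ q) (hQ : IsCube Q) (hf : IntegrableOn f Q) (c : ℝ) :
    ‖(⨍ y in Q, f y) - c‖ₑ ≤ avgNorm q Q (fun x => ‖f x - c‖ₑ) := by
  rw [← average_sub_const hQ hf]
  refine (enorm_average_le _ _).trans ?_
  rw [← avgNorm_one]
  exact avgNorm_mono_exponent hQ hq (aemeasurable_enorm_sub hf c)

theorem avgNorm_sub_average_le (hq : 1 ≤ q) (hQ : IsCube Q) (hf : IntegrableOn f Q) (c : ℝ) :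
    avgNorm q Q (fun x => ‖f x - ⨍ y in Q, f y‖ₑ) ≤ 2 * avgNorm q Q (fun x => ‖f x - c‖ₑ) := by
  set m := ⨍ y in Q, f y with hm
  have h1 : avgNorm q Q (fun x => ‖f x - m‖ₑ) ≤ avgNorm q Q (fun x => ‖f x - c‖ₑ + ‖m - c‖ₑ) := by
    refine avgNorm_mono hQ fun x _ => ?_
    have : f x - m = (f x - c) - (m - c) := by ring
    rw [this]
    exact enorm_sub_le
  refine h1.trans ((avgNorm_add_le hq (aemeasurable_enorm_sub hf c) aemeasurable_const).trans ?_)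
  rw [avgNorm_const hQ (zero_lt_one.trans_le hq).ne', two_mul]
  gcongr
  exact enorm_average_sub_le hq hQ hf c

theorem avgNorm_negPt_le (hq : 1 ≤ q) (hQ : IsCube Q) (hf : IntegrableOn f Q) {c : ℝ}
    (hc : 0 ≤ c) :
    avgNorm 1 Q (fun x => ‖negPt f x‖ₑ) ≤ avgNorm q Q (fun x => ‖f x - c‖ₑ) :=
  (avgNorm_mono hQ fun x _ => enorm_negPt_le f x hc).trans
    (avgNorm_mono_exponent hQ hq (aemeasurable_enorm_sub hf c))

theorem normJN_zero_eq (hp : 1 ≤ p) (hq : 1 ≤ q) (hf : f ∈ LocLp q X) {s : ℝ≥0∞} :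
    normJN p s 0 α X f =
      packingSup p α X fun Q => avgNorm s Q fun x => ‖f x - ⨍ y in Q, f y‖ₑ :=
  packingSup_congr hp fun _ hQ hQX => avgNorm_sub_polyProj hQ (LocLp.integrableOn hq hf hQ hQX)

theorem infQuantity_le_normJNt (hp : 1 ≤ p) (hq : 1 ≤ q) (hf : f ∈ LocLp q X) :
    infQuantity p q α X f ≤ normJNt p q 0 α X f := by
  refine packingSup_mono hp fun Q hQ hQX => ?_
  rw [avgNorm_sub_polyProj_abs hQ (LocLp.integrableOn hq hf hQ hQX)]
  have h0 : 0 ≤ ⨍ y in Q, |f y| := by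
    rw [setAverage_eq]
    exact smul_nonneg (by positivity) (integral_nonneg fun _ => abs_nonneg _)
  exact iInf_le_of_le ⟨_, h0⟩ le_rfl

theorem normJNt_le (hp : 1 ≤ p) (hq : 1 ≤ q) (hf : f ∈ LocLp q X) :
    normJNt p q 0 α X f ≤ 4 * (normJN p q 0 α X f + normRM p 1 α X (negPt f)) := by
  have h := packingSup_le_mul_add (α := α) (X := X) hp 2
    (φ := fun Q => avgNorm q Q fun x => ‖f x - polyProj 0 Q (fun y => |f y|) x‖ₑ)
    (ψ₁ := fun Q => avgNorm q Q fun x => ‖f x - polyProj 0 Q f x‖ₑ)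
    (ψ₂ := fun Q => avgNorm 1 Q fun x => ‖negPt f x‖ₑ) fun Q hQ hQX => ?_
  · refine h.trans_eq ?_
    norm_num [normJN, normRM]
  · have hfQ := LocLp.integrableOn hq hf hQ hQX
    rw [avgNorm_sub_polyProj_abs hQ hfQ, avgNorm_sub_polyProj hQ hfQ, mul_add]
    refine (avgNorm_sub_average_abs_le hq hQ hfQ).trans (add_le_add_left ?_ _)
    exact le_mul_of_one_le_left zero_le (by norm_num)

theorem normJN_add_normRM_le (hp : 1 ≤ p) (hq : 1 ≤ q) (hf : f ∈ LocLp q X) :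
    normJN p q 0 α X f + normRM p 1 α X (negPt f) ≤ 3 * infQuantity p q α X f := by
  have h1 : normJN p q 0 α X f ≤ (2 : ℝ≥0) * infQuantity p q α X f := by
    refine packingSup_le_mul hp _ fun Q hQ hQX => ?_
    have hfQ := LocLp.integrableOn hq hf hQ hQX
    rw [avgNorm_sub_polyProj hQ hfQ, ENNReal.mul_iInf_of_ne (by simp) (by simp)]
    exact le_iInf fun c => by simpa using avgNorm_sub_average_le hq hQ hfQ c
  have h2 : normRM p 1 α X (negPt f) ≤ infQuantity p q α X f :=
    packingSup_mono hp fun Q hQ hQX => le_iInf fun c =>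
      avgNorm_negPt_le hq hQ (LocLp.integrableOn hq hf hQ hQX) c.2
  calc _ ≤ (2 : ℝ≥0) * infQuantity p q α X f + infQuantity p q α X f := add_le_add h1 h2
    _ = 3 * infQuantity p q α X f := by
      rw [ENNReal.coe_ofNat, show (3 : ℝ≥0∞) = 2 + 1 by norm_num, add_mul, one_mul]

end

/-! ### The commutator on indicator functions -/

/-- Slide `[b, b + l]` the least distance that brings it inside `[a, a + L]`: its left end becomes
`b` clamped to `[a, a + L - l]`. Intersecting with `I` keeps exactly the endpoints that `I` allows.
-/
theorem exists_clamped_interval {I J : Set ℝ} {a b l L : ℝ} (hlL : l ≤ L)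
    (hI : Ioo a (a + L) ⊆ I ∧ I ⊆ Icc a (a + L)) (hJ : J ⊆ Icc b (b + l)) :
    ∃ (c : ℝ) (K : Set ℝ), (Ioo c (c + l) ⊆ K ∧ K ⊆ Icc c (c + l)) ∧ K ⊆ I ∧ J ∩ I ⊆ K := by
  have hac : a ≤ max a (min b (a + L - l)) := le_max_left _ _
  have hcL : max a (min b (a + L - l)) ≤ a + L - l := max_le (by linarith) (min_le_right _ _)
  refine ⟨max a (min b (a + L - l)), I ∩ Icc _ _, ⟨?_, inter_subset_right⟩, inter_subset_left, ?_⟩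
  · intro y hy
    exact ⟨hI.1 ⟨hac.trans_lt hy.1, by linarith [hy.2]⟩, Ioo_subset_Icc_self hy⟩
  · rintro y ⟨hyJ, hyI⟩
    have h1 := hJ hyJ
    have h2 := hI.2 hyI
    refine ⟨hyI, max_le h2.1 ((min_le_left _ _).trans h1.1), ?_⟩
    rcases le_total b (a + L - l) with h | h
    · rw [min_eq_left h]
      linarith [h1.2, le_max_right a b]
    · rw [min_eq_right h]
      linarith [h2.2, le_max_right a (a + L - l)]

/-- If `R` has the longer edge, `Q` itself serves; otherwise each edge of `R` is slid into the
corresponding edge of `Q`. -/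
theorem exists_cube_inter_subset {Q R : Set (Fin n → ℝ)} {x : Fin n → ℝ} (hQ : IsCube Q)
    (hR : IsCube R) (hxQ : x ∈ Q) (hxR : x ∈ R) :
    ∃ P, IsCube P ∧ x ∈ P ∧ P ⊆ Q ∧ R ∩ Q ⊆ P ∧ volume P ≤ volume R := by
  obtain ⟨a, L, I, hL, hI, rfl⟩ := hQ
  obtain ⟨b, l, J, hl, hJ, rfl⟩ := hR
  rcases le_total L l with hLl | hlL
  · refine ⟨_, ⟨a, L, I, hL, hI, rfl⟩, hxQ, subset_rfl, inter_subset_right, ?_⟩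
    rw [(isCubeWith_pi hL hI).volume_eq, (isCubeWith_pi hl hJ).volume_eq]
    gcongr
  · choose c K hK hKI hJK using fun i => exists_clamped_interval hlL (hI i) (hJ i).2
    refine ⟨_, ⟨c, l, K, hl, hK, rfl⟩, fun i _ => hJK i ⟨hxR i (mem_univ i), hxQ i (mem_univ i)⟩,
      pi_mono fun i _ => hKI i, fun y hy i _ => hJK i ⟨hy.1 i (mem_univ i), hy.2 i (mem_univ i)⟩, ?_⟩
    rw [(isCubeWith_pi hl hK).volume_eq, (isCubeWith_pi hl hJ).volume_eq]

theorem le_maxFn {X R : Set (Fin n → ℝ)} {x : Fin n → ℝ} (hR : IsCube R) (hx : x ∈ R)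
    (hRX : R ⊆ X) (f : (Fin n → ℝ) → ℝ) :
    (volume R)⁻¹ * ∫⁻ y in R, ‖f y‖ₑ ≤ maxFn X f x :=
  le_iSup₂_of_le R hR (le_iSup₂_of_le hx hRX le_rfl)

theorem maxFn_le {X : Set (Fin n → ℝ)} {x : Fin n → ℝ} {f : (Fin n → ℝ) → ℝ} {B : ℝ≥0∞}
    (h : ∀ R, IsCube R → x ∈ R → R ⊆ X → (volume R)⁻¹ * ∫⁻ y in R, ‖f y‖ₑ ≤ B) :
    maxFn X f x ≤ B :=
  iSup₂_le fun R hR => iSup₂_le fun hx hRX => h R hR hx hRX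

theorem maxFn_indicator_one {X Q : Set (Fin n → ℝ)} {x : Fin n → ℝ} (hQ : IsCube Q)
    (hQX : Q ⊆ X) (hx : x ∈ Q) : maxFn X (Q.indicator fun _ => 1) x = 1 := by
  refine le_antisymm (maxFn_le fun R hR _ _ => ?_) ?_
  · refine (mul_le_mul_right (lintegral_mono (g := fun _ => 1) fun y => ?_) _).trans ?_
    · by_cases hy : y ∈ Q <;> simp [hy]
    · simp [ENNReal.inv_mul_cancel hR.volume_ne_zero hR.volume_ne_top]
  · refine le_trans ?_ (le_maxFn hQ hx hQX _)
    rw [setLIntegral_congr_fun (g := fun _ => 1) hQ.measurableSet fun y hy => by simp [hy]]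
    simp [ENNReal.inv_mul_cancel hQ.volume_ne_zero hQ.volume_ne_top]

/-- Replacing `R` by the cube of `exists_cube_inter_subset` loses none of the mass in `Q` and does
not increase the volume, so only cubes inside `Q` matter. -/
theorem maxFn_mul_indicator {X Q : Set (Fin n → ℝ)} {x : Fin n → ℝ} (hQ : IsCube Q)
    (hQX : Q ⊆ X) (hx : x ∈ Q) (f : (Fin n → ℝ) → ℝ) :
    maxFn X (fun y => f y * Q.indicator (fun _ => 1) y) x = maxFn Q f x := by
  have hind : (fun y => ‖f y * Q.indicator (fun _ => (1 : ℝ)) y‖ₑ) =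
      Q.indicator fun y => ‖f y‖ₑ := by
    ext y
    by_cases hy : y ∈ Q <;> simp [hy]
  refine le_antisymm (maxFn_le fun R hR hxR _ => ?_) (maxFn_le fun R hR hxR hRQ => ?_)
  · obtain ⟨P, hP, hxP, hPQ, hRP, hv⟩ := exists_cube_inter_subset hQ hR hx hxR
    refine le_trans ?_ (le_maxFn hP hxP hPQ f)
    rw [hind, setLIntegral_indicator hQ.measurableSet, inter_comm]
    gcongr
  · refine le_trans (le_of_eq ?_) (le_maxFn hR hxR (hRQ.trans hQX) _)
    rw [hind, setLIntegral_indicator hQ.measurableSet, inter_eq_right.2 hRQ]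

theorem maxQuantity_eq_commQuantity {p q : ℝ≥0∞} (hp : 1 ≤ p) (α : ℝ) (X : Set (Fin n → ℝ))
    (f : (Fin n → ℝ) → ℝ) : maxQuantity p q α X f = commQuantity p q α X f := by
  refine packingSup_congr hp fun Q hQ hQX => avgNorm_congr hQ fun x hx => ?_
  rw [commMax, maxFn_indicator_one hQ hQX hx, maxFn_mul_indicator hQ hQX hx]
  simp

/-! ### Dyadic subcubes and the Calderón–Zygmund decomposition -/

/-- A cube none of whose edges contains its right endpoint. -/
def IsHalfOpenCube (a : Fin n → ℝ) (l : ℝ) (Q : Set (Fin n → ℝ)) : Prop :=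
  0 < l ∧ ∃ I : Fin n → Set ℝ,
    (∀ i, Ioo (a i) (a i + l) ⊆ I i ∧ I i ⊆ Ico (a i) (a i + l)) ∧ Q = univ.pi I

namespace IsHalfOpenCube

variable {a : Fin n → ℝ} {l : ℝ} {Q : Set (Fin n → ℝ)}

theorem isCubeWith (h : IsHalfOpenCube a l Q) : IsCubeWith a l Q := by
  obtain ⟨hl, I, hI, rfl⟩ := h
  exact isCubeWith_pi hl fun i => ⟨(hI i).1, (hI i).2.trans Ico_subset_Icc_self⟩

theorem isCube (h : IsHalfOpenCube a l Q) : IsCube Q := by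
  obtain ⟨hl, I, hI, rfl⟩ := h
  exact ⟨a, l, I, hl, fun i => ⟨(hI i).1, (hI i).2.trans Ico_subset_Icc_self⟩, rfl⟩

end IsHalfOpenCube

/-- The dyadic subcube of `Q` of generation `k` which contains `x`, for a cube `Q` with
corner `a` and edge length `l`. -/
def dyadicCell (a : Fin n → ℝ) (l : ℝ) (Q : Set (Fin n → ℝ)) (k : ℕ) (x : Fin n → ℝ) :
    Set (Fin n → ℝ) :=
  {y ∈ Q | ∀ i, ⌊2 ^ k * ((y i - a i) / l)⌋ = ⌊2 ^ k * ((x i - a i) / l)⌋}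

/-- The index of a cell of generation `k + 1` determines that of its parent; hence the nesting of
dyadic cells. -/
theorem floor_le_floor_of_floor_two_mul_le {u v : ℝ} (h : ⌊2 * u⌋ ≤ ⌊2 * v⌋) : ⌊u⌋ ≤ ⌊v⌋ := by
  rw [Int.le_floor]
  have h1 : 2 * ⌊u⌋ ≤ ⌊2 * u⌋ := by
    rw [Int.le_floor]
    push_cast
    linarith [Int.floor_le u]
  have h2 : ((2 * ⌊u⌋ : ℤ) : ℝ) ≤ 2 * v := Int.le_floor.1 (h1.trans h)
  push_cast at h2
  linarith

section

variable {a : Fin n → ℝ} {l : ℝ} {Q : Set (Fin n → ℝ)} {k : ℕ} {x y : Fin n → ℝ}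

theorem dyadicCell_subset : dyadicCell a l Q k x ⊆ Q := sep_subset _ _

theorem mem_dyadicCell_self (hx : x ∈ Q) : x ∈ dyadicCell a l Q k x := ⟨hx, fun _ => rfl⟩

theorem dyadicCell_eq_of_mem (hy : y ∈ dyadicCell a l Q k x) :
    dyadicCell a l Q k y = dyadicCell a l Q k x := by
  ext z
  simp only [dyadicCell, mem_sep_iff, hy.2]

theorem dyadicCell_succ_subset : dyadicCell a l Q (k + 1) x ⊆ dyadicCell a l Q k x := by
  refine fun y hy => ⟨hy.1, fun i => ?_⟩
  have := hy.2 i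
  rw [pow_succ', mul_assoc, mul_assoc] at this
  exact le_antisymm (floor_le_floor_of_floor_two_mul_le this.le)
    (floor_le_floor_of_floor_two_mul_le this.ge)

theorem dyadicCell_antitone : Antitone fun k => dyadicCell a l Q k x :=
  antitone_nat_of_succ_le fun _ => dyadicCell_succ_subset

/-- The missing right endpoints keep the index of a cell between `0` and `2 ^ k - 1`. A point on a
right face would have index `2 ^ k` and lie in a degenerate cell. -/
theorem isHalfOpenCube_dyadicCell (hQ : IsHalfOpenCube a l Q) (hx : x ∈ Q) (k : ℕ) :
    IsHalfOpenCube (fun i => a i + l / 2 ^ k * ⌊2 ^ k * ((x i - a i) / l)⌋) (l / 2 ^ k)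
      (dyadicCell a l Q k x) := by
  obtain ⟨hl, I, hI, rfl⟩ := hQ
  have h2 : (0 : ℝ) < 2 ^ k := by positivity
  have hl2 : 0 < l / 2 ^ k := by positivity
  have hmem : ∀ (y : ℝ) (i : Fin n) (m : ℤ), ⌊2 ^ k * ((y - a i) / l)⌋ = m ↔
      y ∈ Ico (a i + l / 2 ^ k * m) (a i + l / 2 ^ k * m + l / 2 ^ k) := by
    intro y i m
    have : 2 ^ k * ((y - a i) / l) = (y - a i) / (l / 2 ^ k) := by field_simp
    rw [this, Int.floor_eq_iff, le_div_iff₀ hl2, div_lt_iff₀ hl2, mem_Ico]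
    constructor <;> rintro ⟨h1, h2⟩ <;> constructor <;> linarith
  refine ⟨hl2, fun i => I i ∩ Ico (a i + l / 2 ^ k * ⌊2 ^ k * ((x i - a i) / l)⌋)
    (a i + l / 2 ^ k * ⌊2 ^ k * ((x i - a i) / l)⌋ + l / 2 ^ k), fun i => ⟨?_, inter_subset_right⟩, ?_⟩
  · refine subset_inter (Subset.trans ?_ (hI i).1) Ioo_subset_Ico_self
    have hxi := (hI i).2 (hx i (mem_univ i))
    have h0 : 0 ≤ (x i - a i) / l := div_nonneg (by linarith [hxi.1]) hl.le
    have h1 : (x i - a i) / l < 1 := by rw [div_lt_one hl]; linarith [hxi.2]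
    have hm0 : (0 : ℤ) ≤ ⌊2 ^ k * ((x i - a i) / l)⌋ := Int.floor_nonneg.2 (by positivity)
    have hm1 : ⌊2 ^ k * ((x i - a i) / l)⌋ + 1 ≤ (2 : ℤ) ^ k := by
      rw [Int.add_one_le_iff, Int.floor_lt]
      push_cast
      exact mul_lt_of_lt_one_right h2 h1
    have hm0' : (0 : ℝ) ≤ ⌊2 ^ k * ((x i - a i) / l)⌋ := by exact_mod_cast hm0
    have hm1' : (⌊2 ^ k * ((x i - a i) / l)⌋ : ℝ) + 1 ≤ 2 ^ k := by exact_mod_cast hm1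
    refine Ioo_subset_Ioo (by nlinarith) ?_
    have := mul_le_mul_of_nonneg_left hm1' hl2.le
    rw [div_mul_cancel₀ _ h2.ne'] at this
    linarith
  · ext y
    simp only [dyadicCell, mem_univ_pi, mem_inter_iff, hmem, forall_and]
    exact Iff.rfl

theorem dyadicCell_zero (hQ : IsHalfOpenCube a l Q) (hx : x ∈ Q) : dyadicCell a l Q 0 x = Q := by
  refine dyadicCell_subset.antisymm fun y hy => ⟨hy, fun i => ?_⟩
  obtain ⟨hl, I, hI, rfl⟩ := hQ
  have h0 : ∀ z ∈ univ.pi I, ⌊2 ^ 0 * ((z i - a i) / l)⌋ = 0 := by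
    intro z hz
    have hzi := (hI i).2 (hz i (mem_univ i))
    rw [pow_zero, one_mul, Int.floor_eq_zero_iff]
    exact ⟨div_nonneg (by linarith [hzi.1]) hl.le, by rw [div_lt_one hl]; linarith [hzi.2]⟩
  rw [h0 y hy, h0 x hx]

theorem volume_dyadicCell (hQ : IsHalfOpenCube a l Q) (hx : x ∈ Q) (k : ℕ) :
    volume (dyadicCell a l Q k x) = 2 ^ n * volume (dyadicCell a l Q (k + 1) x) := by
  rw [(isHalfOpenCube_dyadicCell hQ hx k).isCubeWith.volume_eq,
    (isHalfOpenCube_dyadicCell hQ hx (k + 1)).isCubeWith.volume_eq, ← mul_pow]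
  congr 1
  rw [← ENNReal.ofReal_ofNat 2, ← ENNReal.ofReal_mul (by norm_num)]
  congr 1
  rw [pow_succ]
  field_simp

/-- Lebesgue differentiation along the cells containing `x`. Up to a null set each cell is a
sup-metric ball, not centred at `x` but containing it, which the differentiation theorem permits. -/
theorem ae_enorm_le_of_dyadic_averages_le (hQ : IsHalfOpenCube a l Q) {g : (Fin n → ℝ) → ℝ}
    (hg : IntegrableOn g Q) (t : ℝ≥0∞) :
    ∀ᵐ x ∂volume.restrict Q, (∀ k, ∫⁻ y in dyadicCell a l Q k x, ‖g y‖ₑ ≤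
      t * volume (dyadicCell a l Q k x)) → ‖g x‖ₑ ≤ t := by
  have hQm := hQ.isCube.measurableSet
  have hloc : LocallyIntegrable (Q.indicator g) volume :=
    (integrable_indicator_iff hQm |>.2 hg).locallyIntegrable
  rw [ae_restrict_iff' hQm]
  filter_upwards [IsUnifLocDoublingMeasure.ae_tendsto_average volume hloc 1] with x hx hxQ hle
  have hc := fun k => (isHalfOpenCube_dyadicCell hQ hxQ k).isCubeWith
  have hδ : Filter.Tendsto (fun k : ℕ => l / 2 ^ k / 2) Filter.atTop (nhdsWithin 0 (Ioi 0)) := by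
    rw [tendsto_nhdsWithin_iff]
    refine ⟨?_, .of_forall fun k => half_pos (hc k).pos⟩
    have := (tendsto_pow_atTop_nhds_zero_of_lt_one (r := (2 : ℝ)⁻¹) (by norm_num)
      (by norm_num)).const_mul (l / 2)
    rw [mul_zero] at this
    refine this.congr fun k => ?_
    rw [inv_pow]
    field_simp
  have ht := hx _ _ hδ (.of_forall fun k => by
    rw [one_mul]
    exact (hc k).subset_closedBall (mem_dyadicCell_self hxQ))
  rw [indicator_of_mem hxQ] at ht
  refine le_of_tendsto ht.enorm (.of_forall fun k => (enorm_average_le _ _).trans ?_)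
  have hcell := (isHalfOpenCube_dyadicCell hQ hxQ k).isCube
  rw [← measure_congr (hc k).ae_eq_closedBall, ← setLIntegral_congr (hc k).ae_eq_closedBall,
    setLIntegral_congr_fun (g := fun y => ‖g y‖ₑ) hcell.measurableSet fun y hy => by
      simp [dyadicCell_subset hy]]
  rw [mul_comm, ← div_eq_mul_inv]
  exact ENNReal.div_le_of_le_mul (hle k)

/-- The **Calderón–Zygmund decomposition** of a cube at height `t`. -/
theorem exists_calderonZygmund_cubes (hQ : IsHalfOpenCube a l Q) {g : (Fin n → ℝ) → ℝ}
    (hg : IntegrableOn g Q) {t : ℝ≥0∞} (ht : ∫⁻ y in Q, ‖g y‖ₑ ≤ t * volume Q) :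
    ∃ S : Set (Set (Fin n → ℝ)), (∀ P ∈ S, (∃ b m, IsHalfOpenCube b m P) ∧ P ⊆ Q ∧
        t * volume P < ∫⁻ y in P, ‖g y‖ₑ ∧ ∫⁻ y in P, ‖g y‖ₑ ≤ t * (2 ^ n * volume P)) ∧
      S.PairwiseDisjoint id ∧
      ∀ᵐ x ∂volume.restrict Q, x ∉ ⋃₀ S → ‖g x‖ₑ ≤ t := by
  classical
  let D := dyadicCell a l Q
  let bad : ℕ → (Fin n → ℝ) → Prop := fun k x => t * volume (D k x) < ∫⁻ y in D k x, ‖g y‖ₑ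
  -- Select the first bad cell along each chain. Generation `0` is never bad by `ht`, so a selected
  -- cell has a good parent, `2 ^ n` times as large; this gives the upper bound for its average.
  refine ⟨{P | ∃ k, ∃ x ∈ Q, P = D k x ∧ bad k x ∧ ∀ j < k, ¬ bad j x}, ?_, ?_, ?_⟩
  · rintro _ ⟨k, x, hx, rfl, hbad, hmin⟩
    refine ⟨⟨_, _, isHalfOpenCube_dyadicCell hQ hx k⟩, dyadicCell_subset, hbad, ?_⟩
    cases k with
    | zero =>
      simp only [bad, D, dyadicCell_zero hQ hx] at hbad
      exact absurd ht hbad.not_ge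
    | succ k =>
      rw [← volume_dyadicCell hQ hx]
      exact (lintegral_mono_set dyadicCell_succ_subset).trans (not_lt.1 (hmin k k.lt_succ_self))
  · rintro _ ⟨k, x, hx, rfl, hbad, hmin⟩ _ ⟨k', x', hx', rfl, hbad', hmin'⟩ hne
    refine Set.disjoint_left.2 fun z hz hz' => hne ?_
    have key : ∀ {k x}, z ∈ D k x → bad k x → (∀ j < k, ¬ bad j x) →
        bad k z ∧ ∀ j < k, ¬ bad j z := by
      intro k x hz hb hm
      have : ∀ j ≤ k, D j z = D j x := fun j hj =>
        dyadicCell_eq_of_mem (dyadicCell_antitone hj hz)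
      refine ⟨?_, fun j hj => ?_⟩
      · simpa only [bad, this k le_rfl] using hb
      · simpa only [bad, this j hj.le] using hm j hj
    obtain ⟨h1, h2⟩ := key hz hbad hmin
    obtain ⟨h1', h2'⟩ := key hz' hbad' hmin'
    have hk : k = k' := le_antisymm (not_lt.1 fun h => h2 _ h h1') (not_lt.1 fun h => h2' _ h h1)
    subst hk
    exact (dyadicCell_eq_of_mem hz).symm.trans (dyadicCell_eq_of_mem hz')
  · filter_upwards [ae_enorm_le_of_dyadic_averages_le hQ hg t,
      ae_restrict_mem hQ.isCube.measurableSet] with x hx hxQ hxS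
    refine hx fun k => not_lt.1 fun hk => hxS ?_
    have hex : ∃ k, bad k x := ⟨k, hk⟩
    exact ⟨_, ⟨Nat.find hex, x, hxQ, rfl, Nat.find_spec hex, fun j hj => Nat.find_min hex hj⟩,
      mem_dyadicCell_self hxQ⟩

end

/-! ### Self-improvement of mean oscillations -/

theorem tsum_rpow_mul_rpow_le {ι : Type*} [Countable ι] (u v : ι → ℝ≥0∞) {s t : ℝ} (hs : 0 ≤ s)
    (ht : 0 ≤ t) (hst : s + t = 1) :
    ∑' i, u i ^ s * v i ^ t ≤ (∑' i, u i) ^ s * (∑' i, v i) ^ t := by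
  let _ : MeasurableSpace ι := ⊤
  have := ENNReal.lintegral_mul_norm_pow_le (μ := Measure.count) (f := u) (g := v)
    (measurable_from_top).aemeasurable (measurable_from_top).aemeasurable hs ht hst
  simpa only [lintegral_count] using this

theorem lintegral_enorm_sub_average {Q : Set (Fin n → ℝ)} (hQ : IsCube Q)
    (f : (Fin n → ℝ) → ℝ) :
    ∫⁻ x in Q, ‖f x - ⨍ y in Q, f y‖ₑ = meanOsc f Q * volume Q := by
  rw [meanOsc, mul_comm, ← mul_assoc, ENNReal.mul_inv_cancel hQ.volume_ne_zero hQ.volume_ne_top,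
    one_mul]

theorem meanOsc_ne_top {Q : Set (Fin n → ℝ)} (hQ : IsCube Q) {f : (Fin n → ℝ) → ℝ}
    (hf : IntegrableOn f Q) : meanOsc f Q ≠ ∞ := by
  have : IsFiniteMeasure ((volume : Measure (Fin n → ℝ)).restrict Q) :=
    ⟨by simpa using hQ.volume_ne_top.lt_top⟩
  refine ENNReal.mul_ne_top (by simpa using hQ.volume_ne_zero) ?_
  exact (hf.sub (integrable_const _)).2.ne

/-- Calderón–Zygmund decomposition of `f - f_Q` at height twice the mean oscillation: Chebyshev
bounds the selected volume by half of `|Q|`, and the good parents give the jump bound `2 ^ n * 2 *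
meanOsc f Q`. -/
theorem exists_stopping_cubes {a : Fin n → ℝ} {l : ℝ} {Q : Set (Fin n → ℝ)}
    (hQ : IsHalfOpenCube a l Q) {f : (Fin n → ℝ) → ℝ} (hf : IntegrableOn f Q) :
    ∃ S : Set (Set (Fin n → ℝ)), (∀ P ∈ S, (∃ b m, IsHalfOpenCube b m P) ∧ P ⊆ Q ∧
        ‖(⨍ y in P, f y) - ⨍ y in Q, f y‖ₑ ≤ 2 ^ (n + 1) * meanOsc f Q) ∧
      S.PairwiseDisjoint id ∧ IsPacking Q S ∧
      ∑' P : S, volume (P : Set (Fin n → ℝ)) ≤ 2⁻¹ * volume Q ∧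
      ∀ᵐ x ∂volume.restrict Q, x ∉ ⋃₀ S →
        ‖f x - ⨍ y in Q, f y‖ₑ ≤ 2 ^ (n + 1) * meanOsc f Q := by
  have hQc := hQ.isCube
  set c := ⨍ y in Q, f y with hc
  have : IsFiniteMeasure ((volume : Measure (Fin n → ℝ)).restrict Q) :=
    ⟨by simpa using hQc.volume_ne_top.lt_top⟩
  have hg : IntegrableOn (fun x => f x - c) Q := hf.sub (integrable_const _)
  have hosc := lintegral_enorm_sub_average hQc f
  rw [← hc] at hosc
  obtain ⟨S, hS, hdisj, hae⟩ := exists_calderonZygmund_cubes (t := 2 * meanOsc f Q) hQ hg <| by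
    rw [hosc, mul_assoc]
    exact le_mul_of_one_le_left zero_le (by norm_num)
  have hpack : IsPacking Q S := by
    refine ⟨fun P hP => ?_, hdisj.mono fun P => interior_subset⟩
    obtain ⟨⟨b, m, h⟩, hPQ, -⟩ := hS P hP
    exact ⟨h.isCube, hPQ⟩
  refine ⟨S, fun P hP => ?_, hdisj, hpack, ?_, ?_⟩
  · obtain ⟨⟨b, m, h⟩, hPQ, -, hle⟩ := hS P hP
    refine ⟨⟨b, m, h⟩, hPQ, ?_⟩
    rw [← average_sub_const h.isCube (hf.mono_set hPQ)]
    refine (enorm_average_le _ _).trans ?_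
    rw [mul_comm, ← div_eq_mul_inv]
    refine ENNReal.div_le_of_le_mul (hle.trans_eq ?_)
    ring
  · have hcount := hpack.countable.to_subtype
    -- Chebyshev divides by the oscillation. If that vanishes, no cube is selected.
    rcases eq_or_ne (meanOsc f Q) 0 with h0 | h0
    · have : IsEmpty S := by
        refine ⟨fun ⟨P, hP⟩ => ?_⟩
        obtain ⟨-, hPQ, hlt, -⟩ := hS P hP
        have := hlt.trans_le (lintegral_mono_set hPQ)
        rw [hosc, h0] at this
        simp at this
      simp
    · have h1 : 2 * meanOsc f Q * ∑' P : S, volume (P : Set (Fin n → ℝ)) ≤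
          meanOsc f Q * volume Q := by
        rw [← hosc, ← ENNReal.tsum_mul_left]
        calc _ ≤ ∑' P : S, ∫⁻ y in (P : Set (Fin n → ℝ)), ‖f y - c‖ₑ :=
              ENNReal.tsum_le_tsum fun P => (hS P P.2).2.2.1.le
          _ = ∫⁻ y in ⋃ P : S, (P : Set (Fin n → ℝ)), ‖f y - c‖ₑ :=
              (lintegral_iUnion (fun P : S => (hpack.1 P P.2).1.measurableSet)
                (fun (P R : S) hPR => hdisj P.2 R.2 (Subtype.coe_injective.ne hPR)) _).symm
          _ ≤ _ := lintegral_mono_set (iUnion_subset fun P => (hS P P.2).2.1)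
      rw [mul_comm 2, mul_assoc,
        ENNReal.mul_le_mul_iff_right h0 (meanOsc_ne_top hQc hf)] at h1
      rw [mul_comm, ← div_eq_mul_inv]
      exact (ENNReal.le_div_iff_mul_le (by simp) (by simp)).2 (by rwa [mul_comm])
  · filter_upwards [hae] with x hx hxS
    refine (hx hxS).trans (mul_le_mul_left ?_ _)
    rw [pow_succ]
    exact le_mul_of_one_le_left zero_le (one_le_pow₀ (by norm_num))

/-- The functional whose packing sums measure the oscillation of `f` in `L^p`-fashion. -/
def oscWeight (f : (Fin n → ℝ) → ℝ) (p : ℝ) (Q : Set (Fin n → ℝ)) : ℝ≥0∞ :=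
  volume Q * meanOsc f Q ^ p

theorem meanOsc_mul_rpow_le {f : (Fin n → ℝ) → ℝ} {p : ℝ} (hp : 0 < p) {Q : Set (Fin n → ℝ)}
    (hQ : IsCube Q) :
    meanOsc f Q * volume Q ^ (1 / p) ≤ packSum (oscWeight f p) Q ^ (1 / p) := by
  have h := ENNReal.rpow_le_rpow (le_packSum hQ (oscWeight f p)) (one_div_nonneg.2 hp.le)
  refine le_trans (le_of_eq ?_) h
  rw [oscWeight, ENNReal.mul_rpow_of_nonneg _ _ (one_div_nonneg.2 hp.le), ← ENNReal.rpow_mul,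
    mul_one_div_cancel hp.ne', ENNReal.rpow_one, mul_comm]

theorem mul_rpow_mul_rpow_rpow {r : ℝ} (hr : 0 < r) (p : ℝ) (c A B : ℝ≥0∞) :
    (c * (A ^ (1 / p) * B ^ (1 / r - 1 / p))) ^ r = c ^ r * (A ^ (r / p) * B ^ (1 - r / p)) := by
  rw [ENNReal.mul_rpow_of_nonneg _ _ hr.le, ENNReal.mul_rpow_of_nonneg _ _ hr.le,
    ← ENNReal.rpow_mul, ← ENNReal.rpow_mul]
  congr 3 <;> field_simp

/-- Runs `m` generations of stopping cubes and discards the set `E` left uncontrolled. Removing `E`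
makes the estimate finite although `f` is only assumed integrable; the constants stay bounded as `m`
grows. -/
theorem exists_small_set_lintegral_le {f : (Fin n → ℝ) → ℝ} {r p : ℝ} (hr : 1 ≤ r) (hrp : r < p)
    (m : ℕ) : ∀ {a : Fin n → ℝ} {l : ℝ} {Q : Set (Fin n → ℝ)}, IsHalfOpenCube a l Q →
      IntegrableOn f Q → ∃ E, MeasurableSet E ∧ volume E ≤ 2⁻¹ ^ m * volume Q ∧
        (∫⁻ x in Q \ E, ‖f x - ⨍ y in Q, f y‖ₑ ^ r) ^ (1 / r) ≤
          (2 ^ (n + 1) * ∑ j ∈ Finset.range m, ((2⁻¹ : ℝ≥0∞) ^ (1 / r - 1 / p)) ^ j) *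
            (packSum (oscWeight f p) Q ^ (1 / p) * volume Q ^ (1 / r - 1 / p)) := by
  have hr0 : 0 < r := by linarith
  have hp0 : 0 < p := by linarith
  have hθ : 0 < 1 / r - 1 / p := sub_pos.2 (one_div_lt_one_div_of_lt hr0 hrp)
  induction m with
  | zero =>
    intro a l Q hQ _
    -- Discarding all of `Q` leaves an integral over the empty set, matching the empty sum.
    refine ⟨Q, hQ.isCube.measurableSet, by simp, ?_⟩
    simp [hr0]
  | succ m ih =>
    intro a l Q hQ hf
    have hQc := hQ.isCube
    set θ : ℝ≥0∞ := (2⁻¹ : ℝ≥0∞) ^ (1 / r - 1 / p) with hθdef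
    set K : ℝ≥0∞ := 2 ^ (n + 1)
    set c : ℝ≥0∞ := K * ∑ j ∈ Finset.range m, θ ^ j with hc
    obtain ⟨S, hS, hdisj, hpack, hvol, hae⟩ := exists_stopping_cubes hQ hf
    have hcount := hpack.countable.to_subtype
    have hE : ∀ P : S, ∃ E, MeasurableSet E ∧ volume E ≤ 2⁻¹ ^ m * volume (P : Set (Fin n → ℝ)) ∧
        (∫⁻ x in (P : Set (Fin n → ℝ)) \ E, ‖f x - ⨍ y in (P : Set (Fin n → ℝ)), f y‖ₑ ^ r) ^ (1 / r)
          ≤ c * (packSum (oscWeight f p) P ^ (1 / p) *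
            volume (P : Set (Fin n → ℝ)) ^ (1 / r - 1 / p)) := fun P => by
      obtain ⟨⟨b, k, h⟩, hPQ, -⟩ := hS P P.2
      exact ih h (hf.mono_set hPQ)
    choose E hEm hEv hEi using hE
    have hPm : ∀ P : S, MeasurableSet ((P : Set (Fin n → ℝ)) \ E P) := fun P =>
      (hpack.1 P P.2).1.measurableSet.diff (hEm P)
    refine ⟨⋃ P, E P, MeasurableSet.iUnion hEm, ?_, ?_⟩
    · calc volume (⋃ P, E P) ≤ ∑' P, volume (E P) := measure_iUnion_le _
        _ ≤ ∑' P : S, 2⁻¹ ^ m * volume (P : Set (Fin n → ℝ)) := ENNReal.tsum_le_tsum hEv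
        _ = 2⁻¹ ^ m * ∑' P : S, volume (P : Set (Fin n → ℝ)) := ENNReal.tsum_mul_left
        _ ≤ 2⁻¹ ^ m * (2⁻¹ * volume Q) := by gcongr
        _ = 2⁻¹ ^ (m + 1) * volume Q := by rw [pow_succ, mul_assoc]
    let V : S → (Fin n → ℝ) → ℝ≥0∞ := fun P => ((P : Set (Fin n → ℝ)) \ E P).indicator
      fun x => ‖f x - ⨍ y in (P : Set (Fin n → ℝ)), f y‖ₑ
    have hVm : ∀ P, AEMeasurable (V P) (volume.restrict Q) := fun P =>
      (hf.aemeasurable.sub_const _).enorm.indicator (hPm P)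
    -- The stopping cubes are disjoint, so at most one term is nonzero at `x` and the power passes
    -- through the sum.
    have hVr : ∀ x, (∑' P, V P x) ^ r ≤ ∑' P, V P x ^ r := by
      intro x
      by_cases hx : ∃ P : S, x ∈ (P : Set (Fin n → ℝ))
      · obtain ⟨P, hP⟩ := hx
        rw [tsum_eq_single P]
        · exact ENNReal.le_tsum P
        · intro R hR
          refine indicator_of_notMem (fun hxR => ?_) _
          exact Set.disjoint_left.1 (hdisj R.2 P.2 (Subtype.coe_injective.ne hR)) hxR.1 hP
      · have : ∀ P, V P x = 0 := fun P => indicator_of_notMem (fun h => hx ⟨P, h.1⟩) _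
        simp [this, hr0]
    -- The part inside the stopping cubes: the induction hypothesis on each, Hölder with exponents
    -- `r / p` and `1 - r / p`, and superadditivity of `packSum`. The halved total volume produces
    -- the factor `θ`.
    have hVint : (∫⁻ x in Q, (∑' P, V P x) ^ r) ^ (1 / r) ≤
        θ * c * (packSum (oscWeight f p) Q ^ (1 / p) * volume Q ^ (1 / r - 1 / p)) := by
      rw [one_div, ENNReal.rpow_inv_le_iff hr0]
      have hrp' : 0 ≤ r / p := by positivity
      have hrp1 : 0 ≤ 1 - r / p := by
        rw [sub_nonneg, div_le_one hp0]; exact hrp.le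
      calc ∫⁻ x in Q, (∑' P, V P x) ^ r ≤ ∫⁻ x in Q, ∑' P, V P x ^ r := lintegral_mono hVr
        _ = ∑' P, ∫⁻ x in Q, V P x ^ r := lintegral_tsum fun P => (hVm P).pow_const r
        _ ≤ ∑' P : S, c ^ r * (packSum (oscWeight f p) P ^ (r / p) *
              volume (P : Set (Fin n → ℝ)) ^ (1 - r / p)) := by
            refine ENNReal.tsum_le_tsum fun P => ?_
            have hind : (fun x => V P x ^ r) = ((P : Set (Fin n → ℝ)) \ E P).indicator
                fun x => ‖f x - ⨍ y in (P : Set (Fin n → ℝ)), f y‖ₑ ^ r := by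
              ext x
              by_cases hx : x ∈ (P : Set (Fin n → ℝ)) \ E P
              · simp only [V, indicator_of_mem hx]
              · simp only [V, indicator_of_notMem hx, ENNReal.zero_rpow_of_pos hr0]
            rw [hind, setLIntegral_indicator (hPm P)]
            refine (lintegral_mono_set inter_subset_left).trans ?_
            have := hEi P
            rw [one_div, ENNReal.rpow_inv_le_iff hr0, ← one_div] at this
            exact this.trans_eq (mul_rpow_mul_rpow_rpow hr0 p _ _ _)
        _ = c ^ r * ∑' P : S, packSum (oscWeight f p) P ^ (r / p) *
              volume (P : Set (Fin n → ℝ)) ^ (1 - r / p) := ENNReal.tsum_mul_left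
        _ ≤ c ^ r * ((∑' P : S, packSum (oscWeight f p) P) ^ (r / p) *
              (∑' P : S, volume (P : Set (Fin n → ℝ))) ^ (1 - r / p)) := by
            gcongr
            exact tsum_rpow_mul_rpow_le _ _ hrp' hrp1 (by ring)
        _ ≤ c ^ r * (packSum (oscWeight f p) Q ^ (r / p) * (2⁻¹ * volume Q) ^ (1 - r / p)) := by
            gcongr
            exact hpack.tsum_packSum_le _
        _ = _ := by
            have hθr : θ ^ r = 2⁻¹ ^ (1 - r / p) := by
              rw [hθdef, ← ENNReal.rpow_mul]
              congr 1
              field_simp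
            rw [← one_div r, mul_rpow_mul_rpow_rpow hr0 p, ENNReal.mul_rpow_of_nonneg θ c hr0.le,
              hθr, ENNReal.mul_rpow_of_nonneg _ (volume Q) hrp1]
            ring
    -- The jump term of the top generation, a constant on `Q`; `{Q}` as a packing of itself bounds
    -- it by `packSum`.
    have hUint : (∫⁻ x in Q, (K * meanOsc f Q) ^ r) ^ (1 / r) ≤
        K * (packSum (oscWeight f p) Q ^ (1 / p) * volume Q ^ (1 / r - 1 / p)) := by
      rw [setLIntegral_const, ENNReal.mul_rpow_of_nonneg _ _ (by positivity), ← ENNReal.rpow_mul,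
        mul_one_div_cancel hr0.ne', ENNReal.rpow_one, mul_assoc]
      refine mul_le_mul_right ?_ K
      have : volume Q ^ (1 / r) = volume Q ^ (1 / p) * volume Q ^ (1 / r - 1 / p) := by
        rw [← ENNReal.rpow_add _ _ hQc.volume_ne_zero hQc.volume_ne_top]
        congr 1
        ring
      rw [this, ← mul_assoc]
      gcongr
      exact meanOsc_mul_rpow_le hp0 hQc
    have hpt : ∀ᵐ x ∂volume.restrict Q, x ∈ (⋃ P, E P)ᶜ →
        ‖f x - ⨍ y in Q, f y‖ₑ ^ r ≤
          ((fun _ => K * meanOsc f Q) + fun x => ∑' P, V P x : (Fin n → ℝ) → ℝ≥0∞) x ^ r := by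
      filter_upwards [hae] with x hx hxE
      refine ENNReal.rpow_le_rpow ?_ hr0.le
      by_cases hxS : x ∈ ⋃₀ S
      · obtain ⟨P, hPS, hxP⟩ := hxS
        have hxEP : x ∉ E ⟨P, hPS⟩ := fun h => hxE (mem_iUnion_of_mem _ h)
        have h1 : ‖f x - ⨍ y in P, f y‖ₑ ≤ ∑' P, V P x := by
          refine le_trans (le_of_eq ?_) (ENNReal.le_tsum (⟨P, hPS⟩ : S))
          have hx' : x ∈ P \ E ⟨P, hPS⟩ := ⟨hxP, hxEP⟩
          exact (indicator_of_mem hx' fun x => ‖f x - ⨍ y in P, f y‖ₑ).symm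
        have e : f x - ⨍ y in Q, f y =
            ((⨍ y in P, f y) - ⨍ y in Q, f y) + (f x - ⨍ y in P, f y) := by ring
        rw [e]
        exact (enorm_add_le _ _).trans (add_le_add (hS P hPS).2.2 h1)
      · exact (hx hxS).trans le_self_add
    have hmain : ∫⁻ x in Q \ ⋃ P, E P, ‖f x - ⨍ y in Q, f y‖ₑ ^ r ≤
        ∫⁻ x in Q, ((fun _ => K * meanOsc f Q) + fun x => ∑' P, V P x : (Fin n → ℝ) → ℝ≥0∞) x ^ r := by
      have hEU := (MeasurableSet.iUnion hEm).compl
      rw [Set.sdiff_eq, inter_comm, ← Measure.restrict_restrict hEU]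
      exact (lintegral_mono_ae ((ae_restrict_iff' hEU).2 hpt)).trans
        (lintegral_mono' Measure.restrict_le_self le_rfl)
    calc _ ≤ _ := ENNReal.rpow_le_rpow hmain (by positivity)
      _ ≤ _ := ENNReal.lintegral_Lp_add_le aemeasurable_const (AEMeasurable.tsum hVm) hr
      _ ≤ _ := add_le_add hUint hVint
      -- The new term `1` and `θ` times the old geometric sum make up the sum with one more term.
      _ = _ := by
        rw [Finset.sum_range_succ', hc]
        simp only [pow_succ, ← Finset.sum_mul, pow_zero]
        ring

/-- Let `m → ∞`. The volumes of the exceptional sets are summable, so by Borel–Cantelli almost every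
point eventually leaves them, and Fatou's lemma applies. -/
theorem lintegral_sub_average_rpow_le {f : (Fin n → ℝ) → ℝ} {r p : ℝ} (hr : 1 ≤ r) (hrp : r < p)
    {a : Fin n → ℝ} {l : ℝ} {Q : Set (Fin n → ℝ)} (hQ : IsHalfOpenCube a l Q)
    (hf : IntegrableOn f Q) :
    ∫⁻ x in Q, ‖f x - ⨍ y in Q, f y‖ₑ ^ r ≤
      ((2 ^ (n + 1) * (1 - (2⁻¹ : ℝ≥0∞) ^ (1 / r - 1 / p))⁻¹) *
        (packSum (oscWeight f p) Q ^ (1 / p) * volume Q ^ (1 / r - 1 / p))) ^ r := by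
  have hr0 : 0 < r := by linarith
  choose E hEm hEv hEi using fun m => exists_small_set_lintegral_le hr hrp m hQ hf
  set B := ((2 ^ (n + 1) * (1 - (2⁻¹ : ℝ≥0∞) ^ (1 / r - 1 / p))⁻¹) *
        (packSum (oscWeight f p) Q ^ (1 / p) * volume Q ^ (1 / r - 1 / p))) ^ r with hB
  have hsum : ∑' m, volume (E m) ≠ ∞ := by
    refine ne_top_of_le_ne_top ?_ (ENNReal.tsum_le_tsum hEv)
    rw [ENNReal.tsum_mul_right, ENNReal.tsum_geometric]
    exact ENNReal.mul_ne_top (by simp) hQ.isCube.volume_ne_top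
  have hev : ∀ᵐ x ∂volume.restrict Q, ∀ᶠ m in Filter.atTop, x ∉ E m :=
    ae_mono Measure.restrict_le_self (ae_eventually_notMem hsum)
  let F : ℕ → (Fin n → ℝ) → ℝ≥0∞ := fun m => (E m)ᶜ.indicator
    fun x => ‖f x - ⨍ y in Q, f y‖ₑ ^ r
  have hFB : ∀ m, ∫⁻ x in Q, F m x ≤ B := by
    intro m
    rw [setLIntegral_indicator (hEm m).compl, inter_comm, ← Set.sdiff_eq]
    have h := ENNReal.rpow_le_rpow (hEi m) hr0.le
    rw [← ENNReal.rpow_mul, one_div_mul_cancel hr0.ne', ENNReal.rpow_one] at h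
    refine h.trans (ENNReal.rpow_le_rpow (mul_le_mul_left (mul_le_mul_right ?_ _) _) hr0.le)
    rw [← ENNReal.tsum_geometric]
    exact ENNReal.sum_le_tsum _
  calc ∫⁻ x in Q, ‖f x - ⨍ y in Q, f y‖ₑ ^ r
      ≤ ∫⁻ x in Q, Filter.liminf (fun m => F m x) Filter.atTop := by
        refine lintegral_mono_ae ?_
        filter_upwards [hev] with x hx
        refine Filter.le_liminf_of_le (by isBoundedDefault) ?_
        filter_upwards [hx] with m hm
        exact (indicator_of_mem (mem_compl hm) fun x => ‖f x - ⨍ y in Q, f y‖ₑ ^ r).ge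
    _ ≤ Filter.liminf (fun m => ∫⁻ x in Q, F m x) Filter.atTop :=
        lintegral_liminf_le' fun m =>
          ((hf.aemeasurable.sub_const _).enorm.pow_const r).indicator (hEm m).compl
    _ ≤ B := by
        refine (Filter.liminf_le_liminf (.of_forall hFB)).trans ?_
        simp

theorem exists_isHalfOpenCube_ae_eq {Q : Set (Fin n → ℝ)} (hQ : IsCube Q) :
    ∃ a l P, IsHalfOpenCube a l P ∧ P ⊆ Q ∧ P =ᵐ[volume] Q := by
  obtain ⟨a, l, I, hl, hI, rfl⟩ := hQ
  have hP : IsHalfOpenCube a l (univ.pi fun i => Ioo (a i) (a i + l)) :=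
    ⟨hl, _, fun i => ⟨subset_rfl, Ioo_subset_Ico_self⟩, rfl⟩
  refine ⟨a, l, _, hP, pi_mono fun i _ => (hI i).1, ?_⟩
  exact hP.isCubeWith.ae_eq_closedBall.trans (isCubeWith_pi hl hI).ae_eq_closedBall.symm

/-- The constant in the self-improvement inequality for mean oscillations. -/
def selfImprovementConst (n : ℕ) (r p : ℝ) : ℝ≥0∞ :=
  2 ^ (n + 1) * (1 - (2⁻¹ : ℝ≥0∞) ^ (1 / r - 1 / p))⁻¹

theorem selfImprovementConst_ne_top {r p : ℝ} (hr : 1 ≤ r) (hrp : r < p) :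
    selfImprovementConst n r p ≠ ∞ := by
  have hθ : 0 < 1 / r - 1 / p :=
    sub_pos.2 (one_div_lt_one_div_of_lt (by linarith) hrp)
  refine ENNReal.mul_ne_top (by simp) ?_
  rw [ne_eq, ENNReal.inv_eq_top, tsub_eq_zero_iff_le, not_le]
  exact ENNReal.rpow_lt_one (by simp) hθ

/-- All powers of the volume cancel: `1 - p/r + (1/r - 1/p) p = 0`. -/
theorem volume_mul_avgNorm_rpow_le {f : (Fin n → ℝ) → ℝ} {r p : ℝ} (hr : 1 ≤ r) (hrp : r < p)
    {Q : Set (Fin n → ℝ)} (hQ : IsCube Q) (hf : IntegrableOn f Q) :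
    volume Q * avgNorm (ENNReal.ofReal r) Q (fun x => ‖f x - ⨍ y in Q, f y‖ₑ) ^ p ≤
      selfImprovementConst n r p ^ p * packSum (oscWeight f p) Q := by
  have hr0 : 0 < r := by linarith
  have hp0 : 0 < p := by linarith
  obtain ⟨a, l, P, hP, hPQ, hPe⟩ := exists_isHalfOpenCube_ae_eq hQ
  have h := lintegral_sub_average_rpow_le hr hrp hP (hf.mono_set hPQ)
  rw [setLIntegral_congr hPe, setAverage_congr hPe, measure_congr hPe] at h
  rw [avgNorm_ofReal hr0]
  have hV0 := hQ.volume_ne_zero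
  have hV := hQ.volume_ne_top
  set V := volume Q
  set C := selfImprovementConst n r p
  calc V * ((V⁻¹ * ∫⁻ x in Q, ‖f x - ⨍ y in Q, f y‖ₑ ^ r) ^ (1 / r)) ^ p
      ≤ V * ((V⁻¹ * (C * (packSum (oscWeight f p) Q ^ (1 / p) * V ^ (1 / r - 1 / p))) ^ r) ^
          (1 / r)) ^ p := by
        gcongr
        refine h.trans (ENNReal.rpow_le_rpow ?_ hr0.le)
        exact mul_le_mul_right (mul_le_mul_left
          (ENNReal.rpow_le_rpow (packSum_mono_set hPQ _) (by positivity)) _) _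
    _ = C ^ p * packSum (oscWeight f p) Q *
          (V * V ^ (-1 / r * p) * V ^ ((1 / r - 1 / p) * p)) := by
        rw [← ENNReal.rpow_mul, ENNReal.mul_rpow_of_nonneg _ _ (by positivity), ← ENNReal.rpow_mul,
          ← ENNReal.rpow_neg_one, ← ENNReal.rpow_mul,
          show r * (1 / r * p) = p by field_simp, ENNReal.mul_rpow_of_nonneg _ _ hp0.le,
          ENNReal.mul_rpow_of_nonneg _ _ hp0.le, ← ENNReal.rpow_mul, ← ENNReal.rpow_mul,
          one_div_mul_cancel hp0.ne', ENNReal.rpow_one,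
          show -1 * (1 / r * p) = -1 / r * p by ring]
        ring
    _ = C ^ p * packSum (oscWeight f p) Q := by
        nth_rw 1 [← ENNReal.rpow_one V]
        rw [← ENNReal.rpow_add _ _ hV0 hV, ← ENNReal.rpow_add _ _ hV0 hV]
        have : 1 + -1 / r * p + (1 / r - 1 / p) * p = 0 := by field_simp; ring
        rw [this, ENNReal.rpow_zero, mul_one]

theorem rpow_neg_le_rpow_neg {a b : ℝ≥0∞} {α : ℝ} (hα : 0 ≤ α) (hab : a ≤ b) :
    b ^ (-α) ≤ a ^ (-α) := by
  rw [ENNReal.rpow_neg, ENNReal.rpow_neg]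
  exact ENNReal.inv_le_inv.2 (ENNReal.rpow_le_rpow hab hα)

/-- Self-improvement: for `r < p` and `α ≥ 0`, the oscillations in `L^r` are controlled by those
in `L^1`. -/
theorem packingSup_avgNorm_le {p : ℝ≥0∞} {r α : ℝ} (hr : 1 ≤ r) (hrp : ENNReal.ofReal r < p)
    (hα : 0 ≤ α) (n : ℕ) : ∃ C : ℝ≥0, ∀ (X : Set (Fin n → ℝ)) (f : (Fin n → ℝ) → ℝ),
      (∀ Q, IsCube Q → Q ⊆ X → IntegrableOn f Q) →
      packingSup p α X (fun Q => avgNorm (ENNReal.ofReal r) Q fun x => ‖f x - ⨍ y in Q, f y‖ₑ) ≤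
        C * packingSup p α X fun Q => avgNorm 1 Q fun x => ‖f x - ⨍ y in Q, f y‖ₑ := by
  have hp : 1 ≤ p := by
    refine le_trans ?_ hrp.le
    simpa using ENNReal.ofReal_le_ofReal hr
  simp only [avgNorm_one_sub_average]
  rcases eq_or_ne p ∞ with rfl | hp'
  -- For `p = ∞` any finite exponent above `r` can drive the iteration; `r + 1` is taken.
  · have hrt : r < r + 1 := by linarith
    have ht0 : 0 < r + 1 := by linarith
    refine ⟨(selfImprovementConst n r (r + 1)).toNNReal, fun X f hf => ?_⟩
    rw [ENNReal.coe_toNNReal (selfImprovementConst_ne_top hr hrt)]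
    set C := selfImprovementConst n r (r + 1)
    set N := packingSup ∞ α X fun Q => meanOsc f Q with hN
    rw [packingSup_top]
    refine iSup₂_le fun Q hQ => iSup_le fun hQX => ?_
    have hV0 := hQ.volume_ne_zero
    have hV := hQ.volume_ne_top
    -- Here `α ≥ 0` enters, as `|R|^α ≤ |Q|^α`.
    have hosc : ∀ R, IsCube R → R ⊆ Q → meanOsc f R ≤ volume Q ^ α * N := by
      intro R hR hRQ
      have h1 : volume R ^ (-α) * meanOsc f R ≤ N := by
        rw [hN, packingSup_top]
        exact le_iSup₂_of_le R hR (le_iSup_of_le (hRQ.trans hQX) le_rfl)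
      calc meanOsc f R = volume R ^ α * (volume R ^ (-α) * meanOsc f R) := by
            rw [← mul_assoc, ← ENNReal.rpow_add _ _ hR.volume_ne_zero hR.volume_ne_top]
            simp
        _ ≤ _ := by gcongr
    have hsum : packSum (oscWeight f (r + 1)) Q ≤ volume Q * (volume Q ^ α * N) ^ (r + 1) := by
      refine iSup₂_le fun S hS => ?_
      calc ∑' R : S, oscWeight f (r + 1) R
          ≤ ∑' R : S, volume (R : Set (Fin n → ℝ)) * (volume Q ^ α * N) ^ (r + 1) := by
            refine ENNReal.tsum_le_tsum fun R => ?_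
            rw [oscWeight]
            gcongr
            exact hosc R (hS.1 R R.2).1 (hS.1 R R.2).2
        _ ≤ _ := by
            rw [ENNReal.tsum_mul_right]
            gcongr
            exact hS.tsum_volume_le
    have h := (volume_mul_avgNorm_rpow_le hr hrt hQ (hf Q hQ hQX)).trans (mul_le_mul_right hsum _)
    rw [mul_left_comm, ENNReal.mul_le_mul_iff_right hV0 hV,
      ← ENNReal.mul_rpow_of_nonneg _ _ ht0.le, ENNReal.rpow_le_rpow_iff ht0] at h
    calc _ ≤ volume Q ^ (-α) * (C * (volume Q ^ α * N)) := mul_le_mul_right h _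
      _ = (volume Q ^ (-α) * volume Q ^ α) * (C * N) := by ring
      _ = C * N := by
        rw [← ENNReal.rpow_add _ _ hV0 hV]
        simp
  · set t := p.toReal with ht
    have hrt : r < t := (ENNReal.ofReal_lt_iff_lt_toReal (by linarith) hp').1 hrp
    have ht0 : 0 < t := by linarith
    refine ⟨(selfImprovementConst n r t).toNNReal, fun X f hf => ?_⟩
    rw [ENNReal.coe_toNNReal (selfImprovementConst_ne_top hr hrt)]
    set C := selfImprovementConst n r t
    rw [packingSup_of_ne_top hp hp', packingSup_of_ne_top hp hp', ← ht, one_div,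
      ENNReal.rpow_inv_le_iff ht0, ENNReal.mul_rpow_of_nonneg _ _ ht0.le,
      ENNReal.rpow_inv_rpow ht0.ne']
    refine iSup₂_le fun S hS => ?_
    grw [← hS.tsum_packSum_le, ← ENNReal.tsum_mul_left]
    refine ENNReal.tsum_le_tsum fun ⟨Q, hQS⟩ => ?_
    obtain ⟨hQ, hQX⟩ := hS.1 Q hQS
    calc volume Q * (volume Q ^ (-α) *
          avgNorm (ENNReal.ofReal r) Q fun x => ‖f x - ⨍ y in Q, f y‖ₑ) ^ t
        = (volume Q ^ (-α)) ^ t * (volume Q *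
            (avgNorm (ENNReal.ofReal r) Q fun x => ‖f x - ⨍ y in Q, f y‖ₑ) ^ t) := by
          rw [ENNReal.mul_rpow_of_nonneg _ _ ht0.le]
          ring
      _ ≤ (volume Q ^ (-α)) ^ t * (C ^ t * packSum (oscWeight f t) Q) := by
          exact mul_le_mul_right (volume_mul_avgNorm_rpow_le hr hrt hQ (hf Q hQ hQX)) _
      _ = C ^ t * ((volume Q ^ (-α)) ^ t * packSum (oscWeight f t) Q) := by ring
      _ ≤ _ := by
          -- Here `α ≥ 0` enters: `|Q|^{-α} ≤ |R|^{-α}` for `R ⊆ Q`, so the weight of `Q` is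
          -- absorbed by its subcubes.
          refine mul_le_mul_right (packSum_mul_le fun R _ hRQ => ?_) _
          rw [oscWeight, ENNReal.mul_rpow_of_nonneg _ _ ht0.le, mul_left_comm]
          refine mul_le_mul_right (mul_le_mul_left (ENNReal.rpow_le_rpow ?_ ht0.le) _) _
          exact rpow_neg_le_rpow_neg hα (measure_mono hRQ)

/-! ### The maximal function of a cube -/

/-- The weak type `(1, 1)` inequality for the maximal function of a cube. -/
theorem mul_volume_setOf_exists_cube_le (hn : n ≠ 0) {Q : Set (Fin n → ℝ)} (hQ : IsCube Q)
    (h : (Fin n → ℝ) → ℝ≥0∞) (t : ℝ≥0∞) :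
    t * volume {x | ∃ R, IsCube R ∧ x ∈ R ∧ R ⊆ Q ∧ t * volume R < ∫⁻ y in R, h y} ≤
      5 ^ n * ∫⁻ y in Q, h y := by
  obtain ⟨a, l, hal⟩ := hQ.exists_isCubeWith
  let T : Set ((Fin n → ℝ) × ℝ) :=
    {b | ∃ R, IsCubeWith b.1 b.2 R ∧ R ⊆ Q ∧ t * volume R < ∫⁻ y in R, h y}
  have hbound : ∀ b ∈ T, b.2 / 2 ≤ l / 2 := by
    rintro b ⟨R, hR, hRQ, -⟩
    have := measure_mono (μ := volume) hRQ
    rw [hR.volume_eq, hal.volume_eq, ENNReal.pow_le_pow_left_iff hn,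
      ENNReal.ofReal_le_ofReal_iff hal.pos.le] at this
    linarith
  -- Vitali covering by closed sup-metric balls, the closures of the cubes; the enlargement factor 5
  -- is the source of `5 ^ n`.
  obtain ⟨u, huT, hdisj, hcov⟩ := Vitali.exists_disjoint_subfamily_covering_enlargement_closedBall
    T (fun b i => b.1 i + b.2 / 2) (fun b => b.2 / 2) (l / 2) hbound 5 (by norm_num)
  choose R hR hRQ hRt using fun b : u => huT b.2
  have hcount : Countable u := by
    refine (hdisj.countable_of_nonempty_interior fun b hb => ?_).to_subtype
    have := (hR ⟨b, hb⟩).pos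
    exact ⟨_, Metric.ball_subset_interior_closedBall (Metric.mem_ball_self (by linarith))⟩
  have hsub : {x | ∃ R, IsCube R ∧ x ∈ R ∧ R ⊆ Q ∧ t * volume R < ∫⁻ y in R, h y} ⊆
      ⋃ b : u, Metric.closedBall (fun i => b.1.1 i + b.1.2 / 2) (5 * (b.1.2 / 2)) := by
    rintro x ⟨P, hP, hx, hPQ, hlt⟩
    obtain ⟨c, m, hcm⟩ := hP.exists_isCubeWith
    obtain ⟨b, hb, hsub⟩ := hcov (c, m) ⟨P, hcm, hPQ, hlt⟩
    exact mem_iUnion_of_mem ⟨b, hb⟩ (hsub (hcm.subset_closedBall hx))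
  have hvol : ∀ b : u, volume (Metric.closedBall (fun i => b.1.1 i + b.1.2 / 2) (5 * (b.1.2 / 2)))
      = 5 ^ n * volume (R b) := by
    intro b
    have := (hR b).pos
    rw [Real.volume_pi_closedBall _ (by positivity), (hR b).volume_eq, ← mul_pow, Fintype.card_fin,
      ENNReal.ofReal_pow (by positivity)]
    congr 1
    rw [← ENNReal.ofReal_ofNat 5, ← ENNReal.ofReal_mul (by norm_num)]
    congr 1
    ring
  calc _ ≤ t * ∑' b : u, 5 ^ n * volume (R b) := by
        refine mul_le_mul_right ((measure_mono hsub).trans ((measure_iUnion_le _).trans ?_)) _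
        exact ENNReal.tsum_le_tsum fun b => (hvol b).le
    _ = 5 ^ n * ∑' b : u, t * volume (R b) := by
        rw [ENNReal.tsum_mul_left, ENNReal.tsum_mul_left]
        ring
    _ ≤ 5 ^ n * ∑' b : u, ∫⁻ y in R b, h y :=
        mul_le_mul_right (ENNReal.tsum_le_tsum fun b => (hRt b).le) _
    _ = 5 ^ n * ∫⁻ y in ⋃ b : u, R b, h y := by
        rw [lintegral_iUnion (fun b => (hR b).measurableSet)]
        intro b b' hbb'
        exact (hdisj b.2 b'.2 (Subtype.coe_injective.ne hbb')).mono (hR b).subset_closedBall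
          (hR b').subset_closedBall
    _ ≤ _ := mul_le_mul_right (lintegral_mono_set (iUnion_subset hRQ)) _

/-- Weak type `(r, r)` from weak type `(1, 1)`: by Jensen, a cube on which `|F|` has mean above `t`
is one on which `|F|^r` has mean above `t ^ r`. -/
theorem mul_volume_lt_maxFn_le (hn : n ≠ 0) {r : ℝ} (hr : 1 ≤ r) {Q : Set (Fin n → ℝ)}
    (hQ : IsCube Q) {F : (Fin n → ℝ) → ℝ} (hF : AEMeasurable F (volume.restrict Q)) (t : ℝ≥0∞) :
    t ^ r * volume {x | t < maxFn Q F x} ≤ 5 ^ n * ∫⁻ y in Q, ‖F y‖ₑ ^ r := by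
  have hr0 : 0 < r := by linarith
  refine le_trans (mul_le_mul_right (measure_mono fun x hx => ?_) _)
    (mul_volume_setOf_exists_cube_le hn hQ (fun y => ‖F y‖ₑ ^ r) (t ^ r))
  obtain ⟨R, hx⟩ := lt_iSup_iff.1 (show t < maxFn Q F x from hx)
  obtain ⟨hR, hx⟩ := lt_iSup_iff.1 hx
  obtain ⟨hxR, hx⟩ := lt_iSup_iff.1 hx
  obtain ⟨hRQ, hx⟩ := lt_iSup_iff.1 hx
  refine ⟨R, hR, hxR, hRQ, ?_⟩
  have hle : (1 : ℝ≥0∞) ≤ ENNReal.ofReal r := by simpa using ENNReal.ofReal_le_ofReal hr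
  have h1 := avgNorm_mono_exponent hR hle (hF.mono_measure (Measure.restrict_mono hRQ le_rfl)).enorm
  rw [avgNorm_one, avgNorm_ofReal hr0] at h1
  have h2 := hx.trans_le h1
  rw [one_div, ENNReal.lt_rpow_inv_iff hr0, mul_comm, ← div_eq_mul_inv,
    ENNReal.lt_div_iff_mul_lt (.inl hR.volume_ne_zero) (.inl hR.volume_ne_top)] at h2
  exact h2

/-- A dyadic layer-cake bound: for finite `M > t`, the last `k` with `2 ^ k * t < M` has `M ≤ 2 ^ (k
+ 1) * t`, and its term alone suffices. -/
theorem rpow_le_dyadic_sum {q : ℝ} (hq : 0 < q) {M t : ℝ≥0∞} (ht : t ≠ 0) (ht' : t ≠ ∞) :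
    M ^ q ≤ t ^ q * (1 + ∑' k : ℕ, if 2 ^ k * t < M then ((2 : ℝ≥0∞) ^ (k + 1)) ^ q else 0) := by
  by_cases hM : M = ∞
  · have h1 : ∑' k : ℕ, (if 2 ^ k * t < M then ((2 : ℝ≥0∞) ^ (k + 1)) ^ q else 0) = ∞ := by
      rw [← top_le_iff, ← ENNReal.tsum_const_eq_top_of_ne_zero (α := ℕ) (c := 1) one_ne_zero]
      refine ENNReal.tsum_le_tsum fun k => ?_
      rw [if_pos]
      · exact ENNReal.one_le_rpow (one_le_pow₀ (by norm_num)) hq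
      · rw [hM]
        exact ENNReal.mul_lt_top (by simp) ht'.lt_top
    rw [h1, add_top, ENNReal.mul_top]
    · exact le_top
    · simp [ht, ht']
  · have hex : ∃ k : ℕ, M ≤ 2 ^ k * t := by
      obtain ⟨k, hk⟩ := ENNReal.exists_nat_gt (ENNReal.div_lt_top hM ht).ne
      refine ⟨k, (ENNReal.div_le_iff_le_mul (.inl ht) (.inl ht')).1 (hk.le.trans ?_)⟩
      exact_mod_cast Nat.lt_two_pow_self.le
    obtain ⟨hk, hmin⟩ := And.intro (Nat.find_spec hex) fun j hj => Nat.find_min hex (m := j) hj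
    generalize Nat.find hex = k at hk hmin
    rcases k with _ | k
    · rw [pow_zero, one_mul] at hk
      refine (ENNReal.rpow_le_rpow hk hq.le).trans ?_
      exact le_mul_of_one_le_right zero_le le_self_add
    · have hlt := not_le.1 (hmin k k.lt_succ_self)
      calc M ^ q ≤ t ^ q * ((2 : ℝ≥0∞) ^ (k + 1)) ^ q := by
            rw [← ENNReal.mul_rpow_of_nonneg _ _ hq.le, mul_comm t]
            exact ENNReal.rpow_le_rpow hk hq.le
        _ ≤ _ := by
            refine mul_le_mul_right (le_add_left ?_) _
            refine le_trans (le_of_eq ?_) (ENNReal.le_tsum k)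
            rw [if_pos hlt]

/-- The maximal function of a cube is bounded from `L^r` to `L^q` for `q < r`, in the form of a
measurable majorant. -/
theorem exists_maxFn_majorant (hn : n ≠ 0) {q r : ℝ} (hq : 0 < q) (hr : 1 ≤ r) (hqr : q < r) :
    ∃ C : ℝ≥0, ∀ (Q : Set (Fin n → ℝ)), IsCube Q → ∀ F : (Fin n → ℝ) → ℝ,
      AEMeasurable F (volume.restrict Q) → ∃ G : (Fin n → ℝ) → ℝ≥0∞, Measurable G ∧
        (∀ x ∈ Q, maxFn Q F x ≤ G x) ∧
        avgNorm (ENNReal.ofReal q) Q G ≤ C * avgNorm (ENNReal.ofReal r) Q fun x => ‖F x‖ₑ := by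
  have hr0 : 0 < r := by linarith
  -- The `1` accounts for the values up to `t`; the rest is `∑ 2^{(k+1)q} 5^n 2^{-kr}`, convergent
  -- since `q < r`.
  set B : ℝ≥0∞ := 1 + 5 ^ n * 2 ^ q * (1 - (2 : ℝ≥0∞) ^ (q - r))⁻¹ with hB
  have hBtop : B ≠ ∞ := by
    have h1 : (1 - (2 : ℝ≥0∞) ^ (q - r))⁻¹ ≠ ∞ := by
      rw [ne_eq, ENNReal.inv_eq_top, tsub_eq_zero_iff_le, not_le]
      exact ENNReal.rpow_lt_one_of_one_lt_of_neg (by norm_num) (by linarith)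
    have h2 : (2 : ℝ≥0∞) ^ q ≠ ∞ := ENNReal.rpow_ne_top_of_nonneg hq.le (by simp)
    finiteness
  have hB1 : 1 ≤ B := le_self_add
  have hCtop : B ^ (1 / q) ≠ ∞ := ENNReal.rpow_ne_top_of_nonneg (by positivity) hBtop
  have hC1 : 1 ≤ B ^ (1 / q) := ENNReal.one_le_rpow hB1 (by positivity)
  refine ⟨(B ^ (1 / q)).toNNReal, fun Q hQ F hF => ?_⟩
  rw [ENNReal.coe_toNNReal hCtop]
  have hV0 := hQ.volume_ne_zero
  have hV := hQ.volume_ne_top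
  set V := volume Q with hVdef
  set t := avgNorm (ENNReal.ofReal r) Q fun x => ‖F x‖ₑ with ht
  have hle : (1 : ℝ≥0∞) ≤ ENNReal.ofReal r := by simpa using ENNReal.ofReal_le_ofReal hr
  rcases eq_or_ne t 0 with h0 | h0
  · refine ⟨0, measurable_zero, fun x hx => maxFn_le fun R hR _ hRQ => ?_, ?_⟩
    · have h1 := avgNorm_mono_exponent hQ hle hF.enorm
      rw [← ht, h0, avgNorm_one, nonpos_iff_eq_zero, mul_eq_zero] at h1
      have h2 := h1.resolve_left (by simpa using hV)
      have h3 : ∫⁻ y in R, ‖F y‖ₑ = 0 := le_antisymm ((lintegral_mono_set hRQ).trans h2.le) zero_le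
      simp [h3]
    · rw [avgNorm_ofReal hq]
      simp [hq]
  rcases eq_or_ne t ∞ with h1 | h1
  · refine ⟨fun _ => ∞, measurable_const, fun _ _ => le_top, ?_⟩
    rw [h1, ENNReal.mul_top (zero_lt_one.trans_le hC1).ne']
    exact le_top
  have htr : ∫⁻ y in Q, ‖F y‖ₑ ^ r = V * t ^ r := by
    rw [ht, avgNorm_ofReal hr0, ← ENNReal.rpow_mul, one_div_mul_cancel hr0.ne', ENNReal.rpow_one,
      ← mul_assoc, ENNReal.mul_inv_cancel hV0 hV, one_mul]
  -- Measurable hulls of the superlevel sets have the same outer measure. They yield a measurable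
  -- majorant, to which the triangle inequality `avgNorm_add_le` applies.
  let A : ℕ → Set (Fin n → ℝ) := fun k => toMeasurable volume {x | 2 ^ k * t < maxFn Q F x}
  have hAm : ∀ k, MeasurableSet (A k) := fun k => measurableSet_toMeasurable _ _
  have hAv : ∀ k, ((2 : ℝ≥0∞) ^ k) ^ r * volume (A k) ≤ 5 ^ n * V := by
    intro k
    have h := mul_volume_lt_maxFn_le hn hr hQ hF (2 ^ k * t)
    rw [htr, ENNReal.mul_rpow_of_nonneg _ _ hr0.le, mul_right_comm, ← mul_assoc] at h
    rw [measure_toMeasurable]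
    refine (ENNReal.mul_le_mul_iff_left ?_ ?_).1 h
    · simp [h0, h1]
    · exact ENNReal.rpow_ne_top_of_nonneg hr0.le h1
  let S : (Fin n → ℝ) → ℝ≥0∞ := fun x =>
    1 + ∑' k, (A k).indicator (fun _ => ((2 : ℝ≥0∞) ^ (k + 1)) ^ q) x
  have hSm : Measurable S :=
    Measurable.const_add (Measurable.tsum fun k => measurable_const.indicator (hAm k)) 1
  have hSint : ∫⁻ x in Q, S x ≤ V * B := by
    simp only [S]
    rw [lintegral_add_left measurable_const, lintegral_tsum fun k =>
      (measurable_const.indicator (hAm k)).aemeasurable]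
    simp only [lintegral_const, Measure.restrict_apply_univ, one_mul]
    rw [hB, mul_add, mul_one, ← hVdef]
    refine add_le_add_right ?_ _
    calc ∑' k, ∫⁻ x in Q, (A k).indicator (fun _ => ((2 : ℝ≥0∞) ^ (k + 1)) ^ q) x
        ≤ ∑' k : ℕ, V * (5 ^ n * 2 ^ q) * ((2 : ℝ≥0∞) ^ (q - r)) ^ k := by
          refine ENNReal.tsum_le_tsum fun k => ?_
          refine (lintegral_mono' Measure.restrict_le_self le_rfl).trans ?_
          rw [lintegral_indicator_const (hAm k)]
          have e : ((2 : ℝ≥0∞) ^ (k + 1)) ^ q =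
              2 ^ q * ((2 : ℝ≥0∞) ^ (q - r)) ^ k * ((2 : ℝ≥0∞) ^ k) ^ r := by
            simp only [← ENNReal.rpow_natCast, ← ENNReal.rpow_mul]
            rw [← ENNReal.rpow_add _ _ (by simp) (by simp),
              ← ENNReal.rpow_add _ _ (by simp) (by simp)]
            congr 1
            push_cast
            ring
          rw [e, mul_assoc]
          refine (mul_le_mul_right (hAv k) _).trans_eq ?_
          ring
      _ = _ := by
          rw [ENNReal.tsum_mul_left, ENNReal.tsum_geometric]
          ring
  refine ⟨fun x => (t ^ q * S x) ^ (1 / q), (hSm.const_mul _).pow_const _, fun x _ => ?_, ?_⟩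
  · rw [one_div, ENNReal.le_rpow_inv_iff hq]
    refine (rpow_le_dyadic_sum hq h0 h1).trans ?_
    refine mul_le_mul_right (add_le_add_right (ENNReal.tsum_le_tsum fun k => ?_) _) _
    split_ifs with hk
    · have hxA : x ∈ A k :=
        subset_toMeasurable volume _ (show x ∈ {x | 2 ^ k * t < maxFn Q F x} from hk)
      exact (indicator_of_mem hxA fun _ => ((2 : ℝ≥0∞) ^ (k + 1)) ^ q).ge
    · exact zero_le
  · rw [avgNorm_ofReal hq]
    simp only [← ENNReal.rpow_mul, one_div_mul_cancel hq.ne', ENNReal.rpow_one]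
    rw [lintegral_const_mul _ hSm, one_div, ENNReal.rpow_inv_le_iff hq,
      ENNReal.mul_rpow_of_nonneg _ _ hq.le, ENNReal.rpow_inv_rpow hq.ne']
    calc V⁻¹ * (t ^ q * ∫⁻ x in Q, S x) ≤ V⁻¹ * (t ^ q * (V * B)) := by gcongr
      _ = (V⁻¹ * V) * (B * t ^ q) := by ring
      _ = B * t ^ q := by rw [ENNReal.inv_mul_cancel hV0 hV, one_mul]

/-! ### Oscillations and the maximal function -/

theorem le_abs_coe_sub_coe {u c : ℝ} {M : ℝ≥0∞} (hc : ENNReal.ofReal c ≤ M) :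
    ENNReal.ofReal (c - u) ≤ ((u : EReal) - (M : EReal)).abs := by
  rcases eq_or_ne M ∞ with rfl | hM
  · simp
  lift M to ℝ≥0 using hM
  have hc' : c ≤ M := by
    rw [← ENNReal.ofReal_coe_nnreal, ENNReal.ofReal_le_ofReal_iff M.coe_nonneg] at hc
    exact hc
  have e : ((M : ℝ≥0∞) : EReal) = ((M : ℝ) : EReal) := rfl
  rw [e, ← EReal.coe_sub, EReal.abs_def]
  refine ENNReal.ofReal_le_ofReal ?_
  linarith [neg_abs_le (u - M)]

/-- The hypotheses place `M - c` between `0` and `N + (|c| - c)`; the claim follows from `u - M = (u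
- c) - (M - c)`. -/
theorem abs_coe_sub_coe_le {u c : ℝ} {M N d : ℝ≥0∞} (hc : ‖c‖ₑ ≤ M) (hM : M ≤ N + ‖c‖ₑ)
    (hd : ENNReal.ofReal (|c| - c) ≤ d) :
    ((u : EReal) - (M : EReal)).abs ≤ N + (‖u - c‖ₑ + d) := by
  rcases eq_or_ne N ∞ with rfl | hN
  · simp
  have hM' : M ≠ ∞ := ne_top_of_le_ne_top (by finiteness) hM
  lift M to ℝ≥0 using hM'
  lift N to ℝ≥0 using hN
  rw [Real.enorm_eq_ofReal_abs, ← ENNReal.ofReal_coe_nnreal,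
    ENNReal.ofReal_le_ofReal_iff M.coe_nonneg] at hc
  rw [Real.enorm_eq_ofReal_abs, ← ENNReal.ofReal_coe_nnreal, ← ENNReal.ofReal_coe_nnreal (p := N),
    ← ENNReal.ofReal_add N.coe_nonneg (abs_nonneg _),
    ENNReal.ofReal_le_ofReal_iff (add_nonneg N.coe_nonneg (abs_nonneg _))] at hM
  have e : ((M : ℝ≥0∞) : EReal) = ((M : ℝ) : EReal) := rfl
  rw [e, ← EReal.coe_sub, EReal.abs_def]
  calc ENNReal.ofReal |u - M| ≤ ENNReal.ofReal (N + (|u - c| + (|c| - c))) := by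
        refine ENNReal.ofReal_le_ofReal (abs_le.2 ⟨?_, ?_⟩)
        · linarith [neg_abs_le (u - c)]
        · linarith [le_abs_self (u - c), le_abs_self c, N.coe_nonneg]
    _ ≤ _ := by
        have h0 : 0 ≤ |c| - c := sub_nonneg.2 (le_abs_self c)
        rw [ENNReal.ofReal_add N.coe_nonneg (add_nonneg (abs_nonneg _) h0),
          ENNReal.ofReal_add (abs_nonneg _) h0, ENNReal.ofReal_coe_nnreal,
          Real.enorm_eq_ofReal_abs]
        gcongr

theorem maxFn_le_maxFn_sub_add (f : (Fin n → ℝ) → ℝ) (c : ℝ) {Q : Set (Fin n → ℝ)}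
    (x : Fin n → ℝ) : maxFn Q f x ≤ maxFn Q (fun y => f y - c) x + ‖c‖ₑ := by
  refine maxFn_le fun R hR hxR hRQ => ?_
  refine le_trans ?_ (add_le_add_left (le_maxFn hR hxR hRQ _) _)
  calc (volume R)⁻¹ * ∫⁻ y in R, ‖f y‖ₑ ≤ (volume R)⁻¹ * ∫⁻ y in R, (‖f y - c‖ₑ + ‖c‖ₑ) := by
        refine mul_le_mul_right (lintegral_mono fun y => ?_) _
        simpa using enorm_add_le (f y - c) c
    _ = (volume R)⁻¹ * (∫⁻ y in R, ‖f y - c‖ₑ) + ‖c‖ₑ := by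
        rw [lintegral_add_right _ measurable_const, mul_add, setLIntegral_const, mul_comm ‖c‖ₑ,
          ← mul_assoc, ENNReal.inv_mul_cancel hR.volume_ne_zero hR.volume_ne_top, one_mul]

section

variable {f : (Fin n → ℝ) → ℝ} {Q : Set (Fin n → ℝ)}

theorem enorm_average_le_maxFn (hQ : IsCube Q) {x : Fin n → ℝ} (hx : x ∈ Q) :
    ‖⨍ y in Q, f y‖ₑ ≤ maxFn Q f x :=
  (enorm_average_le _ _).trans (le_maxFn hQ hx subset_rfl f)

theorem avgNorm_negPt_le_maxFn {q : ℝ≥0∞} (hq : 1 ≤ q) (hQ : IsCube Q) (hf : IntegrableOn f Q) :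
    avgNorm 1 Q (fun x => ‖negPt f x‖ₑ) ≤
      avgNorm q Q fun x => ((f x : EReal) - (maxFn Q f x : EReal)).abs := by
  have hm : AEMeasurable (fun x => ‖negPt f x‖ₑ) (volume.restrict Q) := by
    rw [negPt_eq]
    exact ((hf.abs.aemeasurable.sub hf.aemeasurable).const_mul _).enorm
  refine (avgNorm_mono_exponent hQ hq hm).trans (avgNorm_mono hQ fun x _ => ?_)
  refine le_trans (le_of_eq ?_) (le_abs_coe_sub_coe (c := 0) (by simp))
  rw [negPt_eq_max, Real.enorm_eq_ofReal (le_max_right _ _), ENNReal.ofReal_max]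
  simp

/-- Since `f - f_Q` has integral zero, its positive and negative parts have equal integrals. Only
the deviation below the mean is directly dominated by `|f - 𝓜_Q(f)|`. -/
theorem meanOsc_eq (hQ : IsCube Q) (hf : IntegrableOn f Q) :
    meanOsc f Q = 2 * avgNorm 1 Q fun x => ENNReal.ofReal ((⨍ y in Q, f y) - f x) := by
  have : IsFiniteMeasure ((volume : Measure (Fin n → ℝ)).restrict Q) :=
    ⟨by simpa using hQ.volume_ne_top.lt_top⟩
  set c := ⨍ y in Q, f y with hc
  have hg : IntegrableOn (fun x => c - f x) Q := (integrable_const c).sub hf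
  have h0 : ∫ x in Q, (c - f x) = 0 := by
    rw [integral_sub (integrable_const c) hf, setIntegral_const, hc, setAverage_eq, smul_smul,
      mul_inv_cancel₀, one_smul, sub_self]
    rw [ne_eq, measureReal_def, ENNReal.toReal_eq_zero_iff]
    simp [hQ.volume_ne_zero, hQ.volume_ne_top]
  have h1 : ∫ x in Q, |c - f x| = 2 * ∫ x in Q, max (c - f x) 0 := by
    have : ∀ x, |c - f x| = 2 * max (c - f x) 0 - (c - f x) := by
      intro x
      rcases le_total 0 (c - f x) with h | h
      · rw [abs_of_nonneg h, max_eq_left h]; ring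
      · rw [abs_of_nonpos h, max_eq_right h]; ring
    simp only [this]
    rw [integral_sub (hg.pos_part.const_mul 2) hg, h0, sub_zero, integral_const_mul]
  have h2 : ∫⁻ x in Q, ‖f x - c‖ₑ = 2 * ∫⁻ x in Q, ENNReal.ofReal (c - f x) := by
    have e1 : ∀ x, ‖f x - c‖ₑ = ENNReal.ofReal |c - f x| := fun x => by
      rw [Real.enorm_eq_ofReal_abs, abs_sub_comm]
    have e2 : ∀ x, ENNReal.ofReal (c - f x) = ENNReal.ofReal (max (c - f x) 0) := fun x => by
      simp [ENNReal.ofReal_max]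
    simp only [e1, e2]
    rw [← ofReal_integral_eq_lintegral_ofReal hg.abs (.of_forall fun _ => abs_nonneg _),
      ← ofReal_integral_eq_lintegral_ofReal hg.pos_part (.of_forall fun _ => le_max_right _ _), h1,
      ENNReal.ofReal_mul (by norm_num), ENNReal.ofReal_ofNat]
  rw [meanOsc, avgNorm_one, ← hc, h2]
  ring

theorem meanOsc_le_maxFn {q : ℝ≥0∞} (hq : 1 ≤ q) (hQ : IsCube Q) (hf : IntegrableOn f Q) :
    meanOsc f Q ≤ 2 * avgNorm q Q fun x => ((f x : EReal) - (maxFn Q f x : EReal)).abs := by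
  rw [meanOsc_eq hQ hf]
  refine mul_le_mul_right ?_ _
  have hm : AEMeasurable (fun x => ENNReal.ofReal ((⨍ y in Q, f y) - f x)) (volume.restrict Q) :=
    (hf.aemeasurable.const_sub _).ennreal_ofReal
  refine (avgNorm_mono_exponent hQ hq hm).trans (avgNorm_mono hQ fun x hx => ?_)
  refine le_abs_coe_sub_coe (le_trans ?_ (enorm_average_le_maxFn hQ hx))
  rw [Real.enorm_eq_ofReal_abs]
  exact ENNReal.ofReal_le_ofReal (le_abs_self _)

/-- The exponent `r > q` on the right leaves room to use only the weak-type bound, and so includes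
`q = 1`, where `𝓜_Q` is not bounded on `L^q`. -/
theorem exists_avgNorm_sub_maxFn_le (hn : n ≠ 0) {q r : ℝ} (hq : 1 ≤ q) (hqr : q < r) :
    ∃ C : ℝ≥0, ∀ (Q : Set (Fin n → ℝ)) (f : (Fin n → ℝ) → ℝ), IsCube Q → IntegrableOn f Q →
      avgNorm (ENNReal.ofReal q) Q (fun x => ((f x : EReal) - (maxFn Q f x : EReal)).abs) ≤
        C * ((avgNorm (ENNReal.ofReal r) Q fun x => ‖f x - ⨍ y in Q, f y‖ₑ) +
          avgNorm 1 Q fun x => ‖negPt f x‖ₑ) := by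
  obtain ⟨C, hC⟩ := exists_maxFn_majorant (n := n) hn (q := q) (r := r) (by linarith) (by linarith)
    hqr
  refine ⟨C + 2, fun Q f hQ hf => ?_⟩
  have hq1 : (1 : ℝ≥0∞) ≤ ENNReal.ofReal q := by simpa using ENNReal.ofReal_le_ofReal hq
  set c := ⨍ y in Q, f y with hc
  set d := avgNorm 1 Q fun x => ‖negPt f x‖ₑ with hd
  obtain ⟨G, hGm, hG, hGle⟩ := hC Q hQ (fun x => f x - c) (hf.aemeasurable.sub_const c)
  have hdc : ENNReal.ofReal (|c| - c) ≤ 2 * d := by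
    refine le_trans ?_ (enorm_average_abs_sub_le hf)
    rw [Real.enorm_eq_ofReal_abs]
    refine ENNReal.ofReal_le_ofReal (le_trans ?_ (le_abs_self _))
    refine sub_le_sub_right ?_ _
    rw [hc, setAverage_eq, setAverage_eq, smul_eq_mul, smul_eq_mul, abs_mul,
      abs_of_nonneg (inv_nonneg.2 measureReal_nonneg)]
    exact mul_le_mul_of_nonneg_left (abs_integral_le_integral_abs)
      (inv_nonneg.2 measureReal_nonneg)
  have hfm := aemeasurable_enorm_sub hf c
  calc avgNorm (ENNReal.ofReal q) Q (fun x => ((f x : EReal) - (maxFn Q f x : EReal)).abs)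
      ≤ avgNorm (ENNReal.ofReal q) Q (fun x => G x + (‖f x - c‖ₑ + 2 * d)) :=
        avgNorm_mono hQ fun x hx => (abs_coe_sub_coe_le (enorm_average_le_maxFn hQ hx)
          (maxFn_le_maxFn_sub_add f c x) hdc).trans (add_le_add_left (hG x hx) _)
    _ ≤ avgNorm (ENNReal.ofReal q) Q G +
          (avgNorm (ENNReal.ofReal q) Q (fun x => ‖f x - c‖ₑ) + 2 * d) := by
        refine (avgNorm_add_le hq1 hGm.aemeasurable (hfm.add_const _)).trans ?_
        refine add_le_add_right ((avgNorm_add_le hq1 hfm aemeasurable_const).trans ?_) _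
        rw [avgNorm_const hQ (zero_lt_one.trans_le hq1).ne']
    _ ≤ C * avgNorm (ENNReal.ofReal r) Q (fun x => ‖f x - c‖ₑ) +
          (avgNorm (ENNReal.ofReal r) Q (fun x => ‖f x - c‖ₑ) + 2 * d) := by
        gcongr
        exact avgNorm_mono_exponent hQ (ENNReal.ofReal_le_ofReal hqr.le) hfm
    _ ≤ _ := by
        set N := avgNorm (ENNReal.ofReal r) Q fun x => ‖f x - c‖ₑ
        push_cast
        calc (C : ℝ≥0∞) * N + (N + 2 * d) ≤ C * N + (2 * N + 2 * d) + C * d := by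
              refine le_trans ?_ le_self_add
              gcongr
              exact le_mul_of_one_le_left zero_le (by norm_num)
          _ = _ := by ring

end

/-! ### Comparison of the maximal quantity with the `JN` and `RM` norms -/

section

variable {p q : ℝ≥0∞} {α : ℝ}

theorem exists_normJN_add_normRM_le_maxQuantity (n : ℕ) (hq : 1 ≤ q) (hqp : q < p) (hα : 0 ≤ α) :
    ∃ C : ℝ≥0, ∀ (X : Set (Fin n → ℝ)), ∀ f ∈ LocLp q X,
      normJN p q 0 α X f + normRM p 1 α X (negPt f) ≤ C * maxQuantity p q α X f := by
  have hp : 1 ≤ p := hq.trans hqp.le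
  have hq' : q ≠ ∞ := hqp.ne_top
  have hqr : ENNReal.ofReal q.toReal = q := ENNReal.ofReal_toReal hq'
  have hq1 : 1 ≤ q.toReal := by simpa using ENNReal.toReal_mono hq' hq
  obtain ⟨C, hC⟩ := packingSup_avgNorm_le (p := p) (α := α) hq1 (by rwa [hqr]) hα n
  refine ⟨C * 2 + 1, fun X f hf => ?_⟩
  have hfQ : ∀ Q, IsCube Q → Q ⊆ X → IntegrableOn f Q := fun Q hQ hQX =>
    LocLp.integrableOn hq hf hQ hQX
  have h1 := hC X f hfQ
  rw [hqr, ← normJN_zero_eq hp hq hf] at h1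
  have h2 : (packingSup p α X fun Q => avgNorm 1 Q fun x => ‖f x - ⨍ y in Q, f y‖ₑ) ≤
      (2 : ℝ≥0) * maxQuantity p q α X f := by
    refine packingSup_le_mul hp 2 fun Q hQ hQX => ?_
    rw [avgNorm_one_sub_average]
    exact meanOsc_le_maxFn hq hQ (hfQ Q hQ hQX)
  have h3 : normRM p 1 α X (negPt f) ≤ maxQuantity p q α X f :=
    packingSup_mono hp fun Q hQ hQX => avgNorm_negPt_le_maxFn hq hQ (hfQ Q hQ hQX)
  calc _ ≤ (C : ℝ≥0∞) * ((2 : ℝ≥0) * maxQuantity p q α X f) + maxQuantity p q α X f :=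
        add_le_add (h1.trans (mul_le_mul_right h2 _)) h3
    _ = _ := by push_cast; ring

theorem exists_maxQuantity_le (hn : n ≠ 0) (hq : 1 ≤ q) (hqp : q < p) (hα : 0 ≤ α) :
    ∃ C : ℝ≥0, ∀ (X : Set (Fin n → ℝ)), ∀ f ∈ LocLp q X,
      maxQuantity p q α X f ≤ C * (normJN p q 0 α X f + normRM p 1 α X (negPt f)) := by
  have hp : 1 ≤ p := hq.trans hqp.le
  have hq' : q ≠ ∞ := hqp.ne_top
  have hqr : ENNReal.ofReal q.toReal = q := ENNReal.ofReal_toReal hq'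
  have hq1 : 1 ≤ q.toReal := by simpa using ENNReal.toReal_mono hq' hq
  -- The intermediate exponent pays twice: `q < r` for the maximal function and `r < p` for
  -- self-improvement.
  obtain ⟨r', hr1, hr2⟩ := ENNReal.lt_iff_exists_nnreal_btwn.1 hqp
  have hr : q.toReal < r' := by
    rw [← hqr, ← ENNReal.ofReal_coe_nnreal] at hr1
    exact (ENNReal.ofReal_lt_ofReal_iff_of_nonneg (by linarith)).1 hr1
  rw [← ENNReal.ofReal_coe_nnreal] at hr2
  set r : ℝ := (r' : ℝ)
  obtain ⟨C₁, hC₁⟩ := exists_avgNorm_sub_maxFn_le hn hq1 hr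
  obtain ⟨C₂, hC₂⟩ := packingSup_avgNorm_le (p := p) (α := α) (hq1.trans hr.le) hr2 hα n
  refine ⟨2 * C₁ * (C₂ + 1), fun X f hf => ?_⟩
  have hfQ : ∀ Q, IsCube Q → Q ⊆ X → IntegrableOn f Q := fun Q hQ hQX =>
    LocLp.integrableOn hq hf hQ hQX
  rw [hqr] at hC₁
  have h1 : maxQuantity p q α X f ≤ 2 * C₁ *
      ((packingSup p α X fun Q => avgNorm (ENNReal.ofReal r) Q fun x => ‖f x - ⨍ y in Q, f y‖ₑ) +
        normRM p 1 α X (negPt f)) :=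
    packingSup_le_mul_add hp C₁ fun Q hQ hQX => hC₁ Q f hQ (hfQ Q hQ hQX)
  have h2 : (packingSup p α X fun Q => avgNorm 1 Q fun x => ‖f x - ⨍ y in Q, f y‖ₑ) ≤
      normJN p q 0 α X f := by
    rw [normJN_zero_eq hp hq hf]
    exact packingSup_mono hp fun Q hQ hQX =>
      avgNorm_mono_exponent hQ hq (aemeasurable_enorm_sub (hfQ Q hQ hQX) _)
  have h3 := (hC₂ X f hfQ).trans (mul_le_mul_right h2 _)
  set J := normJN p q 0 α X f
  set N := normRM p 1 α X (negPt f)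
  calc _ ≤ 2 * C₁ * ((C₂ : ℝ≥0∞) * J + N) := h1.trans (by gcongr)
    -- Terms are added so that the sum factors as `(C₂ + 1) * (J + N)`.
    _ ≤ 2 * C₁ * ((C₂ : ℝ≥0∞) * J + N + (J + C₂ * N)) := mul_le_mul_right le_self_add _
    _ = _ := by push_cast; ring

end

/-! ### Comparable quantities -/

/-- Quantities which are all comparable to a given one are mutually comparable. -/
theorem comparable_of_forall_le {C : ℝ≥0} {l : List ℝ≥0∞} {D : ℝ≥0∞}
    (h₁ : ∀ A ∈ l, A ≤ C * D) (h₂ : ∀ A ∈ l, D ≤ C * A) : Comparable (C * C) l := by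
  intro A hA B hB
  refine (h₁ A hA).trans ((mul_le_mul_right (h₂ B hB) _).trans_eq ?_)
  push_cast
  ring

theorem Comparable.lt_top_iff {C : ℝ≥0} {l : List ℝ≥0∞} (h : Comparable C l) {A B : ℝ≥0∞}
    (hA : A ∈ l) (hB : B ∈ l) : A < ∞ ↔ B < ∞ :=
  ⟨fun hlt => (h B hB A hA).trans_lt (ENNReal.mul_lt_top (by simp) hlt),
    fun hlt => (h A hA B hB).trans_lt (ENNReal.mul_lt_top (by simp) hlt)⟩

/-- Local integrability of `f⁻` is automatic from `f ∈ L^q_loc` and `1 ≤ q`, so only finiteness of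
the norms is at stake. -/
theorem mem_JN_and_mem_RM_iff {p q : ℝ≥0∞} {α : ℝ} {X : Set (Fin n → ℝ)} (hq : 1 ≤ q)
    {f : (Fin n → ℝ) → ℝ} :
    (f ∈ JN p q 0 α X ∧ negPt f ∈ RM p 1 α X) ↔
      f ∈ LocLp q X ∧ normJN p q 0 α X f + normRM p 1 α X (negPt f) < ∞ := by
  rw [ENNReal.add_lt_top]
  exact ⟨fun h => ⟨h.1.1, h.1.2, h.2.2⟩, fun h => ⟨⟨h.1, h.2.1⟩,
    LocLp.mono_exponent hq (LocLp.negPt h.1), h.2.2⟩⟩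

theorem exists_comparable_JN (n : ℕ) {p q : ℝ≥0∞} (hp : 1 ≤ p) (hq : 1 ≤ q) (α : ℝ)
    (X : Set (Fin n → ℝ)) : ∃ C : ℝ≥0, 0 < C ∧ ∀ f ∈ LocLp q X, Comparable C
      [normJNt p q 0 α X f, normJN p q 0 α X f + normRM p 1 α X (negPt f),
        infQuantity p q α X f] := by
  -- `12 = 4 * 3` composes `normJNt_le` with `normJN_add_normRM_le`; it is squared on passing
  -- through `infQuantity`.
  refine ⟨12 * 12, by norm_num, fun f hf => ?_⟩
  have h1 := infQuantity_le_normJNt (α := α) hp hq hf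
  have h2 := normJNt_le (α := α) hp hq hf
  have h3 := normJN_add_normRM_le (α := α) hp hq hf
  set J := normJN p q 0 α X f + normRM p 1 α X (negPt f)
  have hmono : ∀ {a b : ℝ≥0∞} (x : ℝ≥0∞), a ≤ b → a * x ≤ b * x := fun x h => mul_le_mul_left h x
  refine comparable_of_forall_le (D := infQuantity p q α X f) ?_ ?_
  · simp only [List.mem_cons, List.not_mem_nil, or_false, forall_eq_or_imp, forall_eq]
    push_cast
    refine ⟨?_, h3.trans (hmono _ (by norm_num)), le_mul_of_one_le_left zero_le (by norm_num)⟩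
    refine (h2.trans (mul_le_mul_right h3 _)).trans_eq ?_
    rw [← mul_assoc]
    norm_num
  · simp only [List.mem_cons, List.not_mem_nil, or_false, forall_eq_or_imp, forall_eq]
    push_cast
    exact ⟨h1.trans (le_mul_of_one_le_left zero_le (by norm_num)),
      (h1.trans h2).trans (hmono _ (by norm_num)),
      le_mul_of_one_le_left zero_le (by norm_num)⟩

theorem exists_comparable_all (hn : n ≠ 0) {p q : ℝ≥0∞} (hq : 1 ≤ q) (hqp : q < p) {α : ℝ}
    (hα : 0 ≤ α) (X : Set (Fin n → ℝ)) : ∃ C : ℝ≥0, 0 < C ∧ ∀ f ∈ LocLp q X, Comparable C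
      [normJNt p q 0 α X f, normJN p q 0 α X f + normRM p 1 α X (negPt f),
        infQuantity p q α X f, maxQuantity p q α X f, commQuantity p q α X f] := by
  have hp : 1 ≤ p := hq.trans hqp.le
  obtain ⟨C₀, -, h₀⟩ := exists_comparable_JN n hp hq α X
  obtain ⟨C₁, h₁⟩ := exists_normJN_add_normRM_le_maxQuantity n hq hqp hα
  obtain ⟨C₂, h₂⟩ := exists_maxQuantity_le hn hq hqp hα
  set C := max C₀ (max C₁ C₂) + 1 with hC
  have hC0 : (C₀ : ℝ≥0∞) ≤ C := by
    exact_mod_cast (le_max_left _ _).trans (le_add_of_nonneg_right zero_le)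
  have hC1 : (C₁ : ℝ≥0∞) ≤ C := by
    exact_mod_cast ((le_max_left _ _).trans (le_max_right C₀ _)).trans
      (le_add_of_nonneg_right zero_le)
  have hC2 : (C₂ : ℝ≥0∞) ≤ C := by
    exact_mod_cast ((le_max_right _ _).trans (le_max_right C₀ _)).trans
      (le_add_of_nonneg_right zero_le)
  have hCpos : 0 < C := add_pos_of_nonneg_of_pos zero_le one_pos
  refine ⟨C * C, mul_pos hCpos hCpos, fun f hf => ?_⟩
  have h := h₀ f hf
  have hmono : ∀ {a b : ℝ≥0∞} (x : ℝ≥0∞), a ≤ b → a * x ≤ b * x := fun x h => mul_le_mul_left h x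
  have k₁ := (h₁ X f hf).trans (hmono _ hC1)
  have k₂ := (h₂ X f hf).trans (hmono _ hC2)
  rw [← maxQuantity_eq_commQuantity hp]
  refine comparable_of_forall_le
    (D := normJN p q 0 α X f + normRM p 1 α X (negPt f)) ?_ ?_
  · simp only [List.mem_cons, List.not_mem_nil, or_false, forall_eq_or_imp, forall_eq]
    exact ⟨(h _ (by simp) _ (by simp)).trans (hmono _ hC0),
      (h _ (by simp) _ (by simp)).trans (hmono _ hC0),
      (h _ (by simp) _ (by simp)).trans (hmono _ hC0), k₂, k₂⟩
  · simp only [List.mem_cons, List.not_mem_nil, or_false, forall_eq_or_imp, forall_eq]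
    exact ⟨(h _ (by simp) _ (by simp)).trans (hmono _ hC0),
      (h _ (by simp) _ (by simp)).trans (hmono _ hC0),
      (h _ (by simp) _ (by simp)).trans (hmono _ hC0), k₁, k₁⟩

end JNC
end

/-! ### Assembly of the three statements -/

theorem mainTheorem4 (n : ℕ) (hn : 1 ≤ n) (X : Set (Fin n → ℝ))
    (hX : X = Set.univ ∨ JNC.IsCube X) (p q : ℝ≥0∞) (hp : 1 ≤ p) (hq : 1 ≤ q) (α : ℝ) :
    ((∀ f : (Fin n → ℝ) → ℝ, List.TFAE
        [f ∈ JNC.JNt p q 0 α X,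
         f ∈ JNC.JN p q 0 α X ∧ JNC.negPt f ∈ JNC.RM p 1 α X,
         f ∈ JNC.LocLp q X ∧ JNC.infQuantity p q α X f < ∞]) ∧
      ∃ C : ℝ≥0, 0 < C ∧ ∀ f ∈ JNC.LocLp q X, JNC.Comparable C
        [JNC.normJNt p q 0 α X f,
         JNC.normJN p q 0 α X f + JNC.normRM p 1 α X (JNC.negPt f),
         JNC.infQuantity p q α X f]) ∧
    ((∀ f : (Fin n → ℝ) → ℝ,
        (f ∈ JNC.LocLp q X ∧ JNC.maxQuantity p q α X f < ∞) ↔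
        (f ∈ JNC.LocLp q X ∧ JNC.commQuantity p q α X f < ∞)) ∧
      ∃ C : ℝ≥0, 0 < C ∧ ∀ f ∈ JNC.LocLp q X, JNC.Comparable C
        [JNC.maxQuantity p q α X f, JNC.commQuantity p q α X f]) ∧
    (q < p → 0 ≤ α →
      (∀ f : (Fin n → ℝ) → ℝ, List.TFAE
        [f ∈ JNC.JNt p q 0 α X,
         f ∈ JNC.JN p q 0 α X ∧ JNC.negPt f ∈ JNC.RM p 1 α X,
         f ∈ JNC.LocLp q X ∧ JNC.infQuantity p q α X f < ∞,
         f ∈ JNC.LocLp q X ∧ JNC.maxQuantity p q α X f < ∞,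
         f ∈ JNC.LocLp q X ∧ JNC.commQuantity p q α X f < ∞]) ∧
      ∃ C : ℝ≥0, 0 < C ∧ ∀ f ∈ JNC.LocLp q X, JNC.Comparable C
        [JNC.normJNt p q 0 α X f,
         JNC.normJN p q 0 α X f + JNC.normRM p 1 α X (JNC.negPt f),
         JNC.infQuantity p q α X f,
         JNC.maxQuantity p q α X f,
         JNC.commQuantity p q α X f]) := by
  have hJN := JNC.exists_comparable_JN n hp hq α X
  have hBD := fun f => JNC.maxQuantity_eq_commQuantity (q := q) hp α X f
  have key : ∀ (f : (Fin n → ℝ) → ℝ) {A B : ℝ≥0∞} {C : ℝ≥0} {l : List ℝ≥0∞},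
      (f ∈ JNC.LocLp q X → JNC.Comparable C l) → A ∈ l → B ∈ l →
      ((f ∈ JNC.LocLp q X ∧ A < ∞) ↔ (f ∈ JNC.LocLp q X ∧ B < ∞)) :=
    fun f A B C l h hA hB => and_congr_right fun hf => (h hf).lt_top_iff hA hB
  refine ⟨⟨fun f => ?_, hJN⟩, ⟨fun f => by rw [hBD], 1, one_pos, fun f _ => ?_⟩, fun hqp hα => ?_⟩
  · obtain ⟨C, -, h⟩ := hJN
    rw [JNC.mem_JN_and_mem_RM_iff hq]
    tfae_have 1 ↔ 2 := key f (h f) (by simp) (by simp)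
    tfae_have 2 ↔ 3 := key f (h f) (by simp) (by simp)
    tfae_finish
  · rw [hBD]
    simp [JNC.Comparable]
  · have hall := JNC.exists_comparable_all (Nat.one_le_iff_ne_zero.1 hn) hq hqp hα X
    refine ⟨fun f => ?_, hall⟩
    obtain ⟨C, -, h⟩ := hall
    rw [JNC.mem_JN_and_mem_RM_iff hq]
    tfae_have 1 ↔ 2 := key f (h f) (by simp) (by simp)
    tfae_have 2 ↔ 3 := key f (h f) (by simp) (by simp)
    tfae_have 3 ↔ 4 := key f (h f) (by simp) (by simp)
    tfae_have 4 ↔ 5 := key f (h f) (by simp) (by simp)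
    tfae_finish
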